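/- Let $n\in\mathbb N$ and let $\rho$ be a state on $L^2(\mathbb R^n)=L^2(\mathbb R^n,dx;\mathbb C)$, i.e. a positive trace class operator, with trace $\tau(\rho)$ and operator norm $\|\rho\|_\infty$. Let $\widehat f(\xi)=\int_{\mathbb R^n} f(x)e^{-i\langle x,\xi\rangle}\,dx$ be the Fourier transform, extended to a unitary operator from $L^2(\mathbb R^n,dx)$ onto $L^2(\mathbb R^n,d^*\xi)$, where $d^*\xi=(2\pi)^{-n}d\xi$, and let $\widehat\rho$ be the operator on $L^2(\mathbb R^n,d^*\xi)$ given by $\widehat\rho(\widehat f)=\widehat{\rho(f)}$. Let $\nu_\rho(\Omega)=\tau(\rho^{1/2}\chi_\Omega\rho^{1/2})$ be the density measure of $\rho$ on $\mathbb R^n$, where $\chi_\Omega$ is multiplication by the indicator function of $\Omega$, and define $\nu_{\widehat\rho}$ in the same way. Put $$S_x(\rho)=-\int_{\mathbb R^n}\ln\Bigl(\frac{d\nu_\rho}{dx}\Bigr)\,d\nu_\rho,\qquad S_\xi(\widehat\rho)=-\int_{\mathbb R^n}\ln\Bigl(\frac{d\nu_{\widehat\rho}}{d^*\xi}\Bigr)\,d\nu_{\widehat\rho}.$$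 Suppose that the positive part of one of these two expressions is finite (that is, $\int\ln^-(d\nu_\rho/dx)\,d\nu_\rho<\infty$ or $\int\ln^-(d\nu_{\widehat\rho}/d^*\xi)\,d\nu_{\widehat\rho}<\infty$, where $\ln^-=\max(-\ln,0)$). Then the negative part of the other one is finite, so that both are well defined in $[-\infty,+\infty]$, and $$S_x(\rho)+S_\xi(\widehat\rho)\ \ge\ -\tau(\rho)\bigl(\ln\tau(\rho)+\ln\|\rho\|_\infty\bigr).$$ If one of the two entropies is $-\infty$, then the other one is $+\infty$, and the inequality is understood in its rearranged form $S_x(\rho)\ge-\tau(\rho)(\ln\tau(\rho)+\ln\|\rho\|_\infty)-S_\xi(\widehat\rho)$. For $\rho=0$ the right-hand side is read as $0$. -/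

import Mathlib

open MeasureTheory Set
open scoped ENNReal InnerProductSpace

noncomputable section

namespace FourierEntropy

/-! ### Trace of a positive operator -/

section Trace

variable (H : Type*) [NormedAddCommGroup H] [InnerProductSpace ℂ H] [CompleteSpace H]

/-- Index set of a fixed Hilbert basis of `H`. -/
def basisIndex : Set H := Classical.choose (exists_hilbertBasis ℂ H)

/-- A fixed Hilbert basis of `H`. -/
def hilbertBasis : HilbertBasis (basisIndex H) ℂ H :=
  Classical.choose (Classical.choose_spec (exists_hilbertBasis ℂ H))

variable {H}

/-- The trace `τ(T) = ∑ᵢ ⟨eᵢ, T eᵢ⟩ ∈ [0, ∞]` of a positive bounded operator `T`. It does not depend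
on the Hilbert basis: see `trace_eq_tsum`. -/
def trace (T : H →L[ℂ] H) : ℝ≥0∞ :=
  ∑' i, ENNReal.ofReal (⟪hilbertBasis H i, T (hilbertBasis H i)⟫_ℂ).re

/-- A (mixed) state: a positive trace class operator, not necessarily of trace one. -/
structure IsState (ρ : H →L[ℂ] H) : Prop where
  isPositive : ρ.IsPositive
  trace_ne_top : trace ρ ≠ ∞

set_option linter.unusedSectionVars false

/-- Parseval's identity with values in `[0, ∞]`. -/
theorem tsum_sq_inner {ι : Type*} (b : HilbertBasis ι ℂ H) (x : H) :
    ∑' i, ENNReal.ofReal (‖⟪b i, x⟫_ℂ‖ ^ 2) = ENNReal.ofReal (‖x‖ ^ 2) := by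
  have h := b.hasSum_inner_mul_inner x x
  have h2 : HasSum (fun i => ‖⟪b i, x⟫_ℂ‖ ^ 2) (‖x‖ ^ 2) := by
    have h3 := (Complex.hasSum_iff _ _).1 h
    convert! h3.1 using 1
    · funext i
      rw [← inner_conj_symm x (b i), mul_comm, RCLike.mul_conj]
      norm_cast
    · rw [inner_self_eq_norm_sq_to_K]
      norm_cast
  rw [← h2.tsum_eq, ENNReal.ofReal_tsum_of_nonneg (fun _ => by positivity) h2.summable]

/-- `∑ᵢ ‖A eᵢ‖² = ∑ⱼ ‖A* e'ⱼ‖²` for arbitrary Hilbert bases. -/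
theorem tsum_sq_norm_adjoint {ι κ : Type*} (b : HilbertBasis ι ℂ H) (c : HilbertBasis κ ℂ H)
    (A : H →L[ℂ] H) :
    ∑' i, ENNReal.ofReal (‖A (b i)‖ ^ 2) =
      ∑' j, ENNReal.ofReal (‖ContinuousLinearMap.adjoint A (c j)‖ ^ 2) := by
  calc ∑' i, ENNReal.ofReal (‖A (b i)‖ ^ 2)
      = ∑' i, ∑' j, ENNReal.ofReal (‖⟪c j, A (b i)⟫_ℂ‖ ^ 2) := by
        simp_rw [tsum_sq_inner c]
    _ = ∑' j, ∑' i, ENNReal.ofReal (‖⟪c j, A (b i)⟫_ℂ‖ ^ 2) := ENNReal.tsum_comm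
    _ = ∑' j, ∑' i, ENNReal.ofReal (‖⟪b i, ContinuousLinearMap.adjoint A (c j)⟫_ℂ‖ ^ 2) := by
        refine tsum_congr fun j => tsum_congr fun i => ?_
        rw [ContinuousLinearMap.adjoint_inner_right, norm_inner_symm]
    _ = _ := by simp_rw [tsum_sq_inner b]

/-- The positive square root `P^{1/2}` of a positive bounded operator `P`. -/
def opSqrt (P : H →L[ℂ] H) : H →L[ℂ] H := CFC.sqrt P

theorem opSqrt_isPositive (P : H →L[ℂ] H) : (opSqrt P).IsPositive :=
  (ContinuousLinearMap.nonneg_iff_isPositive _).1 (CFC.sqrt_nonneg P)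

theorem inner_opSqrt {P : H →L[ℂ] H} (hP : P.IsPositive) (x : H) :
    (⟪x, P x⟫_ℂ).re = ‖opSqrt P x‖ ^ 2 := by
  have h0 : 0 ≤ P := (ContinuousLinearMap.nonneg_iff_isPositive P).2 hP
  have h2 : P = opSqrt P ∘L opSqrt P := (CFC.sqrt_mul_sqrt_self P h0).symm
  conv_lhs => rw [h2]
  rw [ContinuousLinearMap.comp_apply, ← (opSqrt_isPositive P).inner_left_eq_inner_right,
    inner_self_eq_norm_sq_to_K]
  norm_cast

/-- The trace of a positive operator may be computed in any Hilbert basis. -/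
theorem trace_eq_tsum {ι : Type*} (b : HilbertBasis ι ℂ H) {P : H →L[ℂ] H} (hP : P.IsPositive) :
    trace P = ∑' i, ENNReal.ofReal (⟪b i, P (b i)⟫_ℂ).re := by
  simp_rw [trace, inner_opSqrt hP]
  rw [tsum_sq_norm_adjoint (hilbertBasis H) (hilbertBasis H), ← tsum_sq_norm_adjoint b]

end Trace

/-! ### Density measure of a positive operator on `L²(X, μ)` -/

section Density

variable {X : Type*} [MeasurableSpace X] (μ : Measure X)

/-- The orthogonal projection `χ_Ω` on `L²(X, μ)`: multiplication by the indicator of `Ω`. -/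
def chi (Ω : Set X) (hΩ : MeasurableSet Ω) : Lp ℂ 2 μ →L[ℂ] Lp ℂ 2 μ :=
  LinearMap.mkContinuous
    { toFun := fun f => ((Lp.memLp f).indicator hΩ).toLp (Ω.indicator f)
      map_add' := fun f g => by
        rw [← MemLp.toLp_add, MemLp.toLp_eq_toLp_iff]
        filter_upwards [Lp.coeFn_add f g] with x hx
        by_cases h : x ∈ Ω
        · simpa only [indicator_of_mem h, Pi.add_apply] using hx
        · simp only [indicator_of_notMem h, Pi.add_apply, add_zero]
      map_smul' := fun c f => by
        rw [RingHom.id_apply, ← MemLp.toLp_const_smul, MemLp.toLp_eq_toLp_iff]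
        filter_upwards [Lp.coeFn_smul c f] with x hx
        by_cases h : x ∈ Ω
        · simpa only [indicator_of_mem h, Pi.smul_apply] using hx
        · simp only [indicator_of_notMem h, Pi.smul_apply, smul_zero] }
    1 (fun f => by
        rw [one_mul]
        refine Lp.norm_le_norm_of_ae_le ?_
        filter_upwards [((Lp.memLp f).indicator hΩ).coeFn_toLp] with x hx
        simp only [LinearMap.coe_mk, AddHom.coe_mk, hx]
        exact norm_indicator_le_norm_self f x)

theorem coeFn_chi (Ω : Set X) (hΩ : MeasurableSet Ω) (f : Lp ℂ 2 μ) :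
    chi μ Ω hΩ f =ᵐ[μ] Ω.indicator f :=
  ((Lp.memLp f).indicator hΩ).coeFn_toLp

variable {μ}

theorem inner_chi (Ω : Set X) (hΩ : MeasurableSet Ω) (f : Lp ℂ 2 μ) :
    ENNReal.ofReal (⟪f, chi μ Ω hΩ f⟫_ℂ).re = ∫⁻ x in Ω, ‖f x‖ₑ ^ 2 ∂μ := by
  have h1 : ⟪f, chi μ Ω hΩ f⟫_ℂ = ∫ x, ((Ω.indicator (fun x => ‖f x‖ ^ 2) x : ℝ) : ℂ) ∂μ := by
    rw [L2.inner_def]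
    refine integral_congr_ae ?_
    filter_upwards [coeFn_chi μ Ω hΩ f] with x hx
    rw [hx]
    by_cases h : x ∈ Ω
    · rw [indicator_of_mem h, indicator_of_mem h, inner_self_eq_norm_sq_to_K]
      norm_cast
    · simp [indicator_of_notMem h]
  have h2 : Integrable (fun x => ‖f x‖ ^ 2) μ := (Lp.memLp f).integrable_norm_pow (by norm_num)
  rw [h1, integral_complex_ofReal, Complex.ofReal_re, integral_indicator hΩ,
    ofReal_integral_eq_lintegral_ofReal h2.integrableOn
      (Filter.Eventually.of_forall fun x => by positivity)]
  refine lintegral_congr fun x => ?_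
  rw [ENNReal.ofReal_pow (norm_nonneg _), ofReal_norm]

theorem trace_sqrt_chi_sqrt (P : Lp ℂ 2 μ →L[ℂ] Lp ℂ 2 μ) (Ω : Set X) (hΩ : MeasurableSet Ω) :
    trace (opSqrt P ∘L chi μ Ω hΩ ∘L opSqrt P) =
      ∑' i, ∫⁻ x in Ω, ‖opSqrt P (hilbertBasis (Lp ℂ 2 μ) i) x‖ₑ ^ 2 ∂μ := by
  refine tsum_congr fun i => ?_
  rw [ContinuousLinearMap.comp_apply, ContinuousLinearMap.comp_apply,
    ← (opSqrt_isPositive P).inner_left_eq_inner_right, inner_chi]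

/-- The measure `ν_P(Ω) = τ(P^{1/2} χ_Ω P^{1/2})` of a bounded positive operator `P`. -/
def nu (P : Lp ℂ 2 μ →L[ℂ] Lp ℂ 2 μ) : Measure X :=
  Measure.ofMeasurable
    (fun Ω hΩ => trace (opSqrt P ∘L chi μ Ω hΩ ∘L opSqrt P))
    (by simp [trace_sqrt_chi_sqrt])
    (by
      intro s hs hd
      simp_rw [trace_sqrt_chi_sqrt, lintegral_iUnion hs hd]
      exact ENNReal.tsum_comm)

theorem nu_apply (P : Lp ℂ 2 μ →L[ℂ] Lp ℂ 2 μ) (Ω : Set X) (hΩ : MeasurableSet Ω) :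
    nu P Ω = trace (opSqrt P ∘L chi μ Ω hΩ ∘L opSqrt P) :=
  Measure.ofMeasurable_apply Ω hΩ

end Density

/-! ### Entropy -/

section Entropy

variable {X : Type*} [MeasurableSpace X] (ν m : Measure X)

/-- Positive part of the integral `-∫ ln (dν/dm) dν`. -/
def entropyPos : ℝ≥0∞ := ∫⁻ x, ENNReal.ofReal (-Real.log (ν.rnDeriv m x).toReal) ∂ν

/-- Negative part of the integral `-∫ ln (dν/dm) dν`. -/
def entropyNeg : ℝ≥0∞ := ∫⁻ x, ENNReal.ofReal (Real.log (ν.rnDeriv m x).toReal) ∂ν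

/-- The entropy `-∫ ln (dν/dm) dν ∈ [-∞, ∞]`, meaningful when its positive or its negative part
is finite. -/
def entropy : EReal := (entropyPos ν m : EReal) - (entropyNeg ν m : EReal)

end Entropy

/-! ### Fourier transform -/

section Fourier

variable (n : ℕ)

/-- The space `ℝⁿ`. -/
abbrev Rn : Type := EuclideanSpace ℝ (Fin n)

/-- The Plancherel measure `d*ξ = (2π)⁻ⁿ dξ`. -/
def volStar : Measure (Rn n) := ENNReal.ofReal (((2 * Real.pi) ^ n)⁻¹) • volume

/-- The space `L²(ℝⁿ, dx)` of complex valued functions. -/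
abbrev L2x : Type := Lp ℂ 2 (volume : Measure (Rn n))

/-- The space `L²(ℝⁿ, d*ξ)`. -/
abbrev L2xi : Type := Lp ℂ 2 (volStar n)

/-- The dilation `ξ ↦ (2π)⁻¹ ξ`. -/
def dilation : Rn n ≃ᵐ Rn n :=
  (Homeomorph.smulOfNeZero ((2 * Real.pi)⁻¹ : ℝ) (by positivity)).toMeasurableEquiv

theorem measurePreserving_dilation :
    MeasurePreserving (dilation n) (volStar n) volume := by
  refine ⟨(dilation n).measurable, ?_⟩
  have h : (⇑(dilation n) : Rn n → Rn n) = fun x => ((2 * Real.pi)⁻¹ : ℝ) • x := rfl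
  have hp : (0 : ℝ) < 2 * Real.pi := by positivity
  rw [h, volStar, Measure.map_smul, Measure.map_addHaar_smul volume (inv_pos.2 hp).ne',
    smul_smul, finrank_euclideanSpace, Fintype.card_fin, ← ENNReal.ofReal_mul (by positivity),
    inv_pow, inv_inv, abs_of_pos (by positivity), inv_mul_cancel₀ (by positivity),
    ENNReal.ofReal_one, one_smul]

/-- The unitary dilation `g ↦ g(ξ / 2π)` from `L²(ℝⁿ, dξ)` to `L²(ℝⁿ, d*ξ)`. -/
def dilationL2 : L2x n ≃ₗᵢ[ℂ] L2xi n where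
  toLinearEquiv := LinearEquiv.ofLinearMap
    (Lp.compMeasurePreservingₗ ℂ (dilation n) (measurePreserving_dilation n))
    (Lp.compMeasurePreservingₗ ℂ (dilation n).symm
      ((measurePreserving_dilation n).symm (dilation n)))
    (by
      ext1 f
      change Lp.compMeasurePreserving _ _ (Lp.compMeasurePreserving _ _ f) = f
      rw [← Lp.compMeasurePreserving_comp_apply]
      simp)
    (by
      ext1 f
      change Lp.compMeasurePreserving _ _ (Lp.compMeasurePreserving _ _ f) = f
      rw [← Lp.compMeasurePreserving_comp_apply]
      simp)
  norm_map' f := Lp.norm_compMeasurePreserving f (measurePreserving_dilation n)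

/-- The Fourier transform `f̂(ξ) = ∫ f(x) e^{-i⟨x, ξ⟩} dx` as a unitary operator from `L²(ℝⁿ, dx)`
to `L²(ℝⁿ, d*ξ)`. Mathlib's transform is `𝓕 f(w) = ∫ f(x) e^{-2πi⟨x, w⟩} dx`, whence
`f̂(ξ) = 𝓕 f(ξ / 2π)`. -/
def fourierL2 : L2x n ≃ₗᵢ[ℂ] L2xi n :=
  (Lp.fourierTransformₗᵢ (Rn n) ℂ).trans (dilationL2 n)

variable {n}

/-- The Fourier transform `ρ̂` of an operator, determined by `ρ̂(f̂)` being the transform of `ρ(f)`. -/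
def hatOp (ρ : L2x n →L[ℂ] L2x n) : L2xi n →L[ℂ] L2xi n :=
  (fourierL2 n : _ →L[ℂ] _) ∘L ρ ∘L ((fourierL2 n).symm : _ →L[ℂ] _)

theorem hatOp_fourierL2 (ρ : L2x n →L[ℂ] L2x n) (f : L2x n) :
    hatOp ρ (fourierL2 n f) = fourierL2 n (ρ f) := by
  simp [hatOp]

end Fourier

end FourierEntropy

end

open FourierEntropy

noncomputable section

namespace FourierEntropy

open FourierTransform Filter Topology SchwartzMap

variable {n : ℕ}

/-! With `φᵢ = ρ^{1/2} eᵢ` for a Hilbert basis `eᵢ`, the density measures are `ν = ∑ |φᵢ|² dx` and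
`ν' = ∑ |𝓕φᵢ|² d*ξ`, both of mass `τ`, and Bessel's inequality gives `∑ |⟨k, φᵢ⟩|² ≤ ‖ρ‖ ‖k‖²`. For
bounded `p(x), q(ξ) ≥ 0` consider `F(z) = ∑ ⟨φᵢ, p^z 𝓕⁻¹ q^z 𝓕 φᵢ⟩`. On `Re z = 0`, `|F| ≤ τ`. On
`Re z = 1/2`, if `p` and `q` are integrable, a Hilbert-Schmidt estimate
(`norm_sum_inner_fourierL2_symm_le`) gives `|F| ≤ C = √(‖ρ‖ ∫q) √(∫p) √τ`. By the three lines
theorem `|F(s)| ≤ τ^{1-2s} C^{2s}` for `0 ≤ s ≤ 1/2` (`norm_interpolant_ofReal_le`). For `p, q > 0`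
this is an equality at `s = 0`, and comparing derivatives there gives `∫ ln p dν + ∫ ln q dν' ≤ 2τ
ln(C/τ)` (`integral_log_add_integral_log_le`). When `p` and `q` are the densities themselves, both
integrals are `τ` and the right side is `τ ln(τ‖ρ‖)`.

`F` itself is never differentiated: `re_inner_lower_bound` bounds `Re F(s)` below by an integral
against `ν` plus an integral against `ν'`, with the same value and derivative at `s = 0`. The
analytic part is done for simple functions and finite partial sums.

The densities have to be truncated. Taking `min (dν/dx) N` and letting `N → ∞` gives the inequality
once both logarithms are integrable. Finiteness of a negative part uses `max 1 (min (dν/dx) N)` on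
one side and `min (dν'/d*ξ) 1` on the other. The former need not be integrable, but it is at most
`1` off the set where `dν/dx > 1`, so the bound on `Re z = 1/2` survives with a constant independent
of `N`. -/

instance : SigmaFinite (volStar n) := by
  unfold volStar
  rw [ENNReal.ofReal]
  exact inferInstanceAs (SigmaFinite (Real.toNNReal _ • (volume : Measure (Rn n))))

/-! ### The Fourier transform on `L¹ ∩ L²` -/

theorem continuous_fourierInv_of_integrable {f : Rn n → ℂ} (hf : Integrable f) :
    Continuous (𝓕⁻ f) :=
  VectorFourier.fourierIntegral_continuous (L := -innerₗ (Rn n)) Real.continuous_fourierChar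
    (continuous_inner (𝕜 := ℝ) (E := Rn n)).neg hf

theorem integral_fourierInv_smul_eq_of_integrable {f g : Rn n → ℂ} (hf : Integrable f)
    (hg : Integrable g) : ∫ x, 𝓕⁻ g x • f x = ∫ x, g x • 𝓕⁻ f x := by
  have h := VectorFourier.integral_fourierIntegral_smul_eq_flip (L := -innerₗ (Rn n))
    (μ := volume) (ν := volume) Real.continuous_fourierChar
    (continuous_inner (𝕜 := ℝ) (E := Rn n)).neg hg hf
  have hflip : (-innerₗ (Rn n)).flip = -innerₗ (Rn n) := by
    ext x y : 2
    simp [real_inner_comm]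
  rw [hflip] at h
  exact h

/-- On `L¹ ∩ L²` the inverse Fourier transform is given by the integral. -/
theorem fourierInv_ae_eq (f : L2x n) (hf : Integrable f) :
    (𝓕⁻ f : L2x n) =ᵐ[volume] 𝓕⁻ (f : Rn n → ℂ) := by
  -- Both sides are locally integrable, so testing against `C_c^∞` suffices. The distributional
  -- definition puts the transform on the test function, and Fubini moves it back onto `f`.
  refine ae_eq_of_integral_contDiff_smul_eq
    ((Lp.memLp _).locallyIntegrable one_le_two)
    (continuous_fourierInv_of_integrable hf).locallyIntegrable fun g hg hc => ?_
  have hg₁ : HasCompactSupport (Complex.ofRealCLM ∘ g) := hc.comp_left rfl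
  have hg₂ : ContDiff ℝ (⊤ : ℕ∞) (Complex.ofRealCLM ∘ g) :=
    Complex.ofRealCLM.contDiff.comp hg
  set G : 𝓢(Rn n, ℂ) := hg₁.toSchwartzMap hg₂ with hG
  have hGg : ∀ x, G x = g x := fun x => by simp [hG]
  have h1 := congrArg (fun T => T G) (Lp.fourierInv_toTemperedDistribution_eq f)
  simp only [TemperedDistribution.fourierInv_apply, Lp.toTemperedDistribution_apply] at h1
  have h2 : ∫ x, (𝓕⁻ G) x • f x = ∫ x, G x • 𝓕⁻ (f : Rn n → ℂ) x := by
    rw [SchwartzMap.fourierInv_coe]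
    exact integral_fourierInv_smul_eq_of_integrable hf G.integrable
  have h3 := h1.symm.trans h2
  simpa only [hGg, Complex.coe_smul] using h3

theorem coeFn_dilationL2_symm (g : L2xi n) :
    ((dilationL2 n).symm g : Rn n → ℂ) =ᵐ[volume] g ∘ (dilation n).symm :=
  Lp.coeFn_compMeasurePreserving g ((measurePreserving_dilation n).symm (dilation n))

theorem fourierL2_symm_ae_eq (g : L2xi n) (hg : Integrable g (volStar n)) :
    ((fourierL2 n).symm g : Rn n → ℂ) =ᵐ[volume]
      fun x => ∫ ξ, Complex.exp (Complex.I * (⟪ξ, x⟫_ℝ : ℝ)) * g ξ ∂(volStar n) := by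
  have hmp := (measurePreserving_dilation n).symm (dilation n)
  have h1 := coeFn_dilationL2_symm g
  have hint : Integrable ((dilationL2 n).symm g) :=
    (hmp.integrable_comp_of_integrable hg).congr h1.symm
  have h2 := fourierInv_ae_eq _ hint
  filter_upwards [h2] with x hx
  refine hx.trans ?_
  -- The substitution `w = ξ / 2π` turns the phase `2π⟨w, x⟩` into `⟨ξ, x⟩` and `dw` into `d*ξ`.
  rw [Real.fourierInv_congr_ae h1, Real.fourierInv_eq',
    ← (measurePreserving_dilation n).integral_comp (dilation n).measurableEmbedding]
  refine integral_congr_ae (Eventually.of_forall fun ξ => ?_)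
  have hd : dilation n ξ = ((2 * Real.pi)⁻¹ : ℝ) • ξ := rfl
  simp only [Function.comp_apply, MeasurableEquiv.symm_apply_apply, smul_eq_mul]
  rw [hd, inner_smul_left]
  congr 2
  have hp : (Real.pi : ℂ) ≠ 0 := by exact_mod_cast Real.pi_ne_zero
  push_cast
  simp only [map_inv₀, map_mul, conj_trivial]
  push_cast
  field_simp

/-! ### The trace of `ρ` as a sum over the vectors `ρ^{1/2} eᵢ` -/

section Bessel

variable {H : Type*} [NormedAddCommGroup H] [InnerProductSpace ℂ H] [CompleteSpace H]

theorem norm_opSqrt_sq_le {P : H →L[ℂ] H} (hP : P.IsPositive) (x : H) :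
    ‖opSqrt P x‖ ^ 2 ≤ ‖P‖ * ‖x‖ ^ 2 := by
  rw [← inner_opSqrt hP]
  calc (⟪x, P x⟫_ℂ).re ≤ ‖⟪x, P x⟫_ℂ‖ := Complex.re_le_norm _
    _ ≤ ‖x‖ * ‖P x‖ := norm_inner_le_norm _ _
    _ ≤ ‖x‖ * (‖P‖ * ‖x‖) := by gcongr; exact P.le_opNorm x
    _ = ‖P‖ * ‖x‖ ^ 2 := by ring

/-- Self-adjointness moves `P^{1/2}` onto `k`; then Bessel's inequality applies, together with
`‖P^{1/2} k‖² = ⟨k, P k⟩`. This is how the operator norm of `ρ` enters the final bound. -/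
theorem sum_sq_norm_inner_opSqrt_le {ι : Type*} {P : H →L[ℂ] H} (hP : P.IsPositive) {e : ι → H}
    (he : Orthonormal ℂ e) (I : Finset ι) (k : H) :
    ∑ i ∈ I, ‖⟪k, opSqrt P (e i)⟫_ℂ‖ ^ 2 ≤ ‖P‖ * ‖k‖ ^ 2 := by
  refine le_trans (le_of_eq ?_)
    ((he.sum_inner_products_le (opSqrt P k) (s := I)).trans (norm_opSqrt_sq_le hP k))
  refine Finset.sum_congr rfl fun i _ => ?_
  rw [← (opSqrt_isPositive P).inner_left_eq_inner_right, norm_inner_symm]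

end Bessel

theorem integral_norm_sq {X : Type*} [MeasurableSpace X] {μ : Measure X} (f : Lp ℂ 2 μ) :
    ∫ x, ‖f x‖ ^ 2 ∂μ = ‖f‖ ^ 2 := by
  have h := inner_self_eq_norm_sq_to_K (𝕜 := ℂ) f
  rw [L2.inner_def] at h
  simp_rw [inner_self_eq_norm_sq_to_K] at h
  rw [← Complex.ofReal_inj, ← integral_complex_ofReal]
  push_cast
  exact h

/-! ### Hilbert-Schmidt estimate for `P(x) Q(ξ)` -/

/-- If the vectors `φᵢ` are dominated in the sense of Bessel, then `∑ᵢ ⟨P φᵢ, F⁻¹ Q F φᵢ⟩` is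
estimated by the `L²` norms of the functions `P` and `Q`. -/
theorem norm_sum_inner_fourierL2_symm_le {ι : Type*} {φ : ι → L2x n} {R τ a b : ℝ} (hR0 : 0 ≤ R)
    (I : Finset ι) (hR : ∀ k : L2x n, ∑ i ∈ I, ‖⟪k, φ i⟫_ℂ‖ ^ 2 ≤ R * ‖k‖ ^ 2)
    (hτ : ∑ i ∈ I, ‖φ i‖ ^ 2 ≤ τ) {P Q : Rn n → ℂ} (hP : MemLp P 2 volume)
    (ha : ∫ x, ‖P x‖ ^ 2 ≤ a) (hQ : MemLp Q 2 (volStar n))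
    (hb : ∫ ξ, ‖Q ξ‖ ^ 2 ∂(volStar n) ≤ b) {f : ι → L2x n} {g : ι → L2xi n}
    (hf : ∀ i, f i =ᵐ[volume] fun x => P x * φ i x)
    (hg : ∀ i, g i =ᵐ[volStar n] fun ξ => Q ξ * fourierL2 n (φ i) ξ) :
    ‖∑ i ∈ I, ⟪f i, (fourierL2 n).symm (g i)⟫_ℂ‖ ≤ √(R * b) * (√a * √τ) := by
  -- the integral kernel of `F⁻¹ Q`
  set K : Rn n → Rn n → ℂ := fun x ξ =>
    Complex.exp (-(Complex.I * (⟪ξ, x⟫_ℝ : ℝ))) * (starRingEnd ℂ) (Q ξ) with hK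
  have hKnorm : ∀ x ξ, ‖K x ξ‖ = ‖Q ξ‖ := fun x ξ => by
    simp [hK, Complex.norm_exp]
  have hKmem : ∀ x, MemLp (K x) 2 (volStar n) := fun x => by
    refine hQ.of_le ?_ (Eventually.of_forall fun ξ => (hKnorm x ξ).le)
    refine AEStronglyMeasurable.mul ?_ (Complex.continuous_conj.comp_aestronglyMeasurable hQ.1)
    exact Continuous.aestronglyMeasurable (by fun_prop)
  set k : Rn n → L2xi n := fun x => (hKmem x).toLp with hk
  have hkn : ∀ x, ‖k x‖ ^ 2 ≤ b := fun x => by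
    refine le_trans (le_of_eq ?_) hb
    rw [← integral_norm_sq]
    refine integral_congr_ae ?_
    filter_upwards [(hKmem x).coeFn_toLp] with ξ hξ
    rw [hk, hξ, hKnorm]
  set c : ι → Rn n → ℂ := fun i x => ⟪k x, fourierL2 n (φ i)⟫_ℂ with hc
  -- The phase in the kernel is unimodular, so `k x` has the norm of `Q` for every `x`. The Bessel
  -- bound for the `φᵢ` is therefore uniform in `x`.
  have hcb : ∀ x, ∑ i ∈ I, ‖c i x‖ ^ 2 ≤ R * b := fun x => by
    have h1 : ∀ i, c i x = ⟪(fourierL2 n).symm (k x), φ i⟫_ℂ := fun i => by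
      rw [hc, ← (fourierL2 n).inner_map_map, LinearIsometryEquiv.apply_symm_apply]
    simp_rw [h1]
    refine (hR _).trans ?_
    rw [LinearIsometryEquiv.norm_map]
    gcongr
    exact hkn x
  have hcg : ∀ i, ((fourierL2 n).symm (g i) : Rn n → ℂ) =ᵐ[volume] c i := fun i => by
    have hint : Integrable (g i) (volStar n) :=
      (hQ.integrable_mul (Lp.memLp (fourierL2 n (φ i)))).congr (hg i).symm
    refine (fourierL2_symm_ae_eq _ hint).trans (Eventually.of_forall fun x => ?_)
    simp only [hc]
    rw [L2.inner_def]
    refine integral_congr_ae ?_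
    filter_upwards [hg i, (hKmem x).coeFn_toLp] with ξ h1 h2
    rw [h1, hk, h2, RCLike.inner_apply, hK]
    simp only [map_mul, Complex.conj_conj, ← Complex.exp_conj, map_neg, Complex.conj_I,
      Complex.conj_ofReal, neg_mul, neg_neg]
    ring
  -- Cauchy-Schwarz is used twice: over `i` at fixed `x`, which produces `S x`, and then over `x`
  -- for the product `‖P‖ S`.
  set S : Rn n → ℝ := fun x => √(∑ i ∈ I, ‖φ i x‖ ^ 2) with hS
  have hφint : ∀ i, Integrable (fun x => ‖φ i x‖ ^ 2) := fun i =>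
    (Lp.memLp (φ i)).integrable_norm_pow (by norm_num)
  have hS2 : ∀ x, S x ^ 2 = ∑ i ∈ I, ‖φ i x‖ ^ 2 := fun x => Real.sq_sqrt (by positivity)
  have hSm : MemLp S 2 volume := by
    have hm : AEStronglyMeasurable S volume := by
      refine Real.continuous_sqrt.comp_aestronglyMeasurable ?_
      exact (integrable_finsetSum I fun i _ => hφint i).1
    rw [memLp_two_iff_integrable_sq hm]
    simp_rw [hS2]
    exact integrable_finsetSum I fun i _ => hφint i
  have hSint : ∫ x, S x ^ 2 ≤ τ := by
    simp_rw [hS2]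
    rw [integral_finsetSum I fun i _ => hφint i]
    refine le_trans (Finset.sum_le_sum fun i _ => le_of_eq ?_) hτ
    exact integral_norm_sq (φ i)
  have hPS : Integrable fun x => ‖P x‖ * S x := hP.norm.integrable_mul hSm
  have hpt : ∀ᵐ x, ‖∑ i ∈ I, ⟪f i x, (fourierL2 n).symm (g i) x⟫_ℂ‖ ≤
      √(R * b) * (‖P x‖ * S x) := by
    have h1 : ∀ᵐ x, ∀ i ∈ I, f i x = P x * φ i x :=
      (ae_ball_iff I.countable_toSet).2 fun i _ => hf i
    have h2 : ∀ᵐ x, ∀ i ∈ I, (fourierL2 n).symm (g i) x = c i x :=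
      (ae_ball_iff I.countable_toSet).2 fun i _ => hcg i
    filter_upwards [h1, h2] with x hx1 hx2
    calc ‖∑ i ∈ I, ⟪f i x, (fourierL2 n).symm (g i) x⟫_ℂ‖
        ≤ ∑ i ∈ I, ‖⟪f i x, (fourierL2 n).symm (g i) x⟫_ℂ‖ := norm_sum_le _ _
      _ = ‖P x‖ * ∑ i ∈ I, ‖φ i x‖ * ‖c i x‖ := by
        rw [Finset.mul_sum]
        refine Finset.sum_congr rfl fun i hi => ?_
        rw [hx1 i hi, hx2 i hi, RCLike.inner_apply, norm_mul, RCLike.norm_conj, norm_mul]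
        ring
      _ ≤ ‖P x‖ * (S x * √(R * b)) := by
        gcongr
        refine (Real.sum_mul_le_sqrt_mul_sqrt I _ _).trans ?_
        gcongr
        exact hcb x
      _ = _ := by ring
  calc ‖∑ i ∈ I, ⟪f i, (fourierL2 n).symm (g i)⟫_ℂ‖
      = ‖∫ x, ∑ i ∈ I, ⟪f i x, (fourierL2 n).symm (g i) x⟫_ℂ‖ := by
        rw [integral_finsetSum I fun i _ => L2.integrable_inner _ _]
        rfl
    _ ≤ ∫ x, √(R * b) * (‖P x‖ * S x) := norm_integral_le_of_norm_le (hPS.const_mul _) hpt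
    _ = √(R * b) * ∫ x, ‖P x‖ * S x := integral_const_mul _ _
    _ ≤ √(R * b) * (√a * √τ) := by
        gcongr
        have h := integral_mul_le_Lp_mul_Lq_of_nonneg (μ := (volume : Measure (Rn n)))
          Real.HolderConjugate.two_two
          (Eventually.of_forall fun x => norm_nonneg (P x))
          (Eventually.of_forall fun x => Real.sqrt_nonneg (∑ i ∈ I, ‖φ i x‖ ^ 2))
          (by simpa using hP.norm) (by simpa using hSm)
        refine h.trans ?_
        simp only [Real.rpow_two, ← Real.sqrt_eq_rpow]
        gcongr

/-! ### Complex powers of nonnegative simple functions as multiplication operators -/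

/-- The complex power `a ^ z` of a real number `a ≥ 0`, with `0 ^ z = 0` for all `z`. -/
def cpowZero (z : ℂ) (a : ℝ) : ℂ := if a = 0 then 0 else Complex.exp (z * (Real.log a : ℝ))

theorem norm_cpowZero {z : ℂ} {a : ℝ} (ha : 0 < a) : ‖cpowZero z a‖ = a ^ z.re := by
  rw [cpowZero, if_neg ha.ne', Complex.norm_exp, Real.rpow_def_of_pos ha]
  simp [mul_comm]

theorem norm_cpowZero_le_one {z : ℂ} (hz : z.re = 0) {a : ℝ} (ha : 0 ≤ a) :
    ‖cpowZero z a‖ ≤ 1 := by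
  rcases ha.eq_or_lt with rfl | ha
  · simp [cpowZero]
  · rw [norm_cpowZero ha, hz, Real.rpow_zero]

theorem norm_cpowZero_half {z : ℂ} (hz : z.re = 1 / 2) {a : ℝ} (ha : 0 ≤ a) :
    ‖cpowZero z a‖ = √a := by
  rcases ha.eq_or_lt with rfl | ha
  · simp [cpowZero]
  · rw [norm_cpowZero ha, hz, Real.sqrt_eq_rpow]

/-- A crude bound: the three lines theorem needs some bound inside the strip, whose value does not
enter its conclusion. -/
theorem norm_cpowZero_le {z : ℂ} (h0 : 0 ≤ z.re) (h1 : z.re ≤ 1) {a M : ℝ} (ha : 0 ≤ a)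
    (haM : a ≤ M) : ‖cpowZero z a‖ ≤ 1 + M := by
  rcases ha.eq_or_lt with rfl | ha
  · simp [cpowZero]; linarith
  · rw [norm_cpowZero ha]
    rcases le_total a 1 with h | h
    · exact (Real.rpow_le_one ha.le h h0).trans (by linarith)
    · exact (Real.rpow_le_rpow_of_exponent_le h h1).trans (by rw [Real.rpow_one]; linarith)

theorem cpowZero_ofReal {s : ℝ} (hs : s ≠ 0) {a : ℝ} (ha : 0 ≤ a) :
    cpowZero s a = ((a ^ s : ℝ) : ℂ) := by
  rcases ha.eq_or_lt with rfl | ha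
  · simp [cpowZero, Real.zero_rpow hs]
  · rw [cpowZero, if_neg ha.ne', Real.rpow_def_of_pos ha]
    push_cast
    rw [mul_comm]

/-- The inner product is conjugate linear in its first slot, so the exponent there must be
conjugated for the dependence on `z` to be holomorphic. -/
theorem conj_cpowZero_conj (z : ℂ) (a : ℝ) :
    (starRingEnd ℂ) (cpowZero ((starRingEnd ℂ) z) a) = cpowZero z a := by
  unfold cpowZero
  split_ifs <;> simp [← Complex.exp_conj]

theorem differentiable_cpowZero (a : ℝ) : Differentiable ℂ fun z => cpowZero z a := by
  unfold cpowZero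
  split_ifs <;> fun_prop

section PowVec

variable {X : Type*} [MeasurableSpace X] {μ : Measure X}

/-- The vector `p ^ z f`, for a nonnegative simple function `p`. -/
def powVec (p : SimpleFunc X ℝ) (z : ℂ) (f : Lp ℂ 2 μ) : Lp ℂ 2 μ :=
  ∑ a ∈ p.range, cpowZero z a • chi μ (p ⁻¹' {a}) (p.measurableSet_fiber a) f

theorem coeFn_powVec (p : SimpleFunc X ℝ) (z : ℂ) (f : Lp ℂ 2 μ) :
    powVec p z f =ᵐ[μ] fun x => cpowZero z (p x) * f x := by
  have h1 : ∀ᵐ x ∂μ, ∀ a ∈ p.range,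
      (cpowZero z a • chi μ (p ⁻¹' {a}) (p.measurableSet_fiber a) f : Lp ℂ 2 μ) x =
        cpowZero z a * (p ⁻¹' {a}).indicator f x := by
    refine (ae_ball_iff p.range.countable_toSet).2 fun a _ => ?_
    filter_upwards [Lp.coeFn_smul (cpowZero z a)
      (chi μ (p ⁻¹' {a}) (p.measurableSet_fiber a) f),
      coeFn_chi μ (p ⁻¹' {a}) (p.measurableSet_fiber a) f] with x hx1 hx2
    rw [hx1, Pi.smul_apply, hx2, smul_eq_mul]
  filter_upwards [h1, Lp.coeFn_finsetSum p.range fun a =>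
    cpowZero z a • chi μ (p ⁻¹' {a}) (p.measurableSet_fiber a) f] with x hx1 hx2
  rw [powVec, hx2, Finset.sum_apply, Finset.sum_congr rfl hx1,
    Finset.sum_eq_single_of_mem (p x) (p.mem_range_self x)]
  · simp
  · intro a _ ha
    rw [indicator_of_notMem (by simpa using ha.symm), mul_zero]

theorem norm_chi_powVec_le (p : SimpleFunc X ℝ) (z : ℂ) (f : Lp ℂ 2 μ) {B : Set X}
    (hB : MeasurableSet B) {c : ℝ} (hc0 : 0 ≤ c) (hc : ∀ x ∈ B, ‖cpowZero z (p x)‖ ≤ c) :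
    ‖chi μ B hB (powVec p z f)‖ ≤ c * ‖f‖ := by
  refine Lp.norm_le_mul_norm_of_ae_le_mul ?_
  filter_upwards [coeFn_chi μ B hB (powVec p z f), coeFn_powVec p z f] with x h1 h2
  rw [h1]
  by_cases hx : x ∈ B
  · rw [indicator_of_mem hx, h2, norm_mul]
    gcongr
    exact hc x hx
  · rw [indicator_of_notMem hx, norm_zero]
    positivity

theorem chi_add_chi_compl {B : Set X} (hB : MeasurableSet B) (f : Lp ℂ 2 μ) :
    chi μ B hB f + chi μ Bᶜ hB.compl f = f := by
  refine Lp.ext ?_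
  filter_upwards [Lp.coeFn_add (chi μ B hB f) (chi μ Bᶜ hB.compl f), coeFn_chi μ B hB f,
    coeFn_chi μ Bᶜ hB.compl f] with x h1 h2 h3
  rw [h1, Pi.add_apply, h2, h3]
  by_cases hx : x ∈ B <;> simp [hx]

theorem norm_powVec_le (p : SimpleFunc X ℝ) (z : ℂ) (f : Lp ℂ 2 μ) {c : ℝ}
    (hc : ∀ x, ‖cpowZero z (p x)‖ ≤ c) : ‖powVec p z f‖ ≤ c * ‖f‖ := by
  refine Lp.norm_le_mul_norm_of_ae_le_mul ?_
  filter_upwards [coeFn_powVec p z f] with x h2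
  rw [h2, norm_mul]
  gcongr
  exact hc x

/-- The measure `|f|² dμ`. -/
def vecMeasure (f : Lp ℂ 2 μ) : Measure X := μ.withDensity fun x => ‖f x‖ₑ ^ 2

theorem integral_vecMeasure (f : Lp ℂ 2 μ) (h : X → ℝ) :
    ∫ x, h x ∂(vecMeasure f) = ∫ x, ‖f x‖ ^ 2 * h x ∂μ := by
  rw [vecMeasure, integral_withDensity_eq_integral_toReal_smul]
  · simp
  · exact ((Lp.stronglyMeasurable f).measurable.enorm).pow_const 2
  · exact Eventually.of_forall fun x => by simp

theorem integral_powVec (p : SimpleFunc X ℝ) (hp : ∀ x, 0 ≤ p x) {s : ℝ} (hs : s ≠ 0)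
    (f : Lp ℂ 2 μ) :
    ∫ x, (2 * p x ^ s - (p x ^ s) ^ 2 / 2 - 1) ∂(vecMeasure f) =
      2 * (⟪powVec p s f, f⟫_ℂ).re - ‖powVec p s f‖ ^ 2 / 2 - ‖f‖ ^ 2 := by
  have h1 : (fun x => ‖f x‖ ^ 2 * (2 * p x ^ s - (p x ^ s) ^ 2 / 2 - 1)) =ᵐ[μ] fun x =>
      2 * (⟪powVec p s f x, f x⟫_ℂ).re - ‖powVec p s f x‖ ^ 2 / 2 - ‖f x‖ ^ 2 := by
    filter_upwards [coeFn_powVec p s f] with x hx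
    rw [hx, cpowZero_ofReal hs (hp x), RCLike.inner_apply, norm_mul, Complex.norm_real,
      Real.norm_of_nonneg (Real.rpow_nonneg (hp x) s), map_mul, Complex.conj_ofReal]
    have : f x * ((p x ^ s : ℝ) * (starRingEnd ℂ) (f x)) = ((p x ^ s * ‖f x‖ ^ 2 : ℝ) : ℂ) := by
      rw [mul_left_comm, Complex.mul_conj']
      push_cast
      ring
    rw [this, Complex.ofReal_re]
    ring
  have hi1 : Integrable (fun x => (⟪powVec p s f x, f x⟫_ℂ).re) μ :=
    (L2.integrable_inner (𝕜 := ℂ) (powVec p s f) f).re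
  have hi2 : ∀ g : Lp ℂ 2 μ, Integrable (fun x => ‖g x‖ ^ 2) μ := fun g =>
    (Lp.memLp g).integrable_norm_pow (by norm_num)
  rw [integral_vecMeasure, integral_congr_ae h1, integral_sub, integral_sub, integral_const_mul,
    integral_div, integral_norm_sq, integral_norm_sq, L2.inner_def]
  · congr 3
    exact integral_re (L2.integrable_inner (𝕜 := ℂ) (powVec p s f) f)
  · exact hi1.const_mul 2
  · exact (hi2 _).div_const 2
  · exact (hi1.const_mul 2).sub ((hi2 _).div_const 2)
  · exact hi2 f

end PowVec

/-- This is `‖f + g - 2h‖² ≥ 0` expanded. It decouples position from momentum: with `f = p^s φ`, `g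
= 𝓕⁻¹ q^s 𝓕 φ` and `h = φ`, each summand on the left involves only one of `p` and `q`. The loss is
quadratic in the deviation of `f + g` from `2h`, hence invisible to the derivative at `s = 0`. -/
theorem re_inner_lower_bound {H : Type*} [NormedAddCommGroup H] [InnerProductSpace ℂ H]
    (f g h : H) :
    (2 * (⟪f, h⟫_ℂ).re - ‖f‖ ^ 2 / 2 - ‖h‖ ^ 2) + (2 * (⟪g, h⟫_ℂ).re - ‖g‖ ^ 2 / 2 - ‖h‖ ^ 2) ≤
      (⟪f, g⟫_ℂ).re := by
  have h1 := norm_add_sq (𝕜 := ℂ) (f + g) (-(2 : ℂ) • h)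
  have h2 := norm_add_sq (𝕜 := ℂ) f g
  have h3 : RCLike.re ⟪f + g, -(2 : ℂ) • h⟫_ℂ = -2 * (⟪f, h⟫_ℂ).re - 2 * (⟪g, h⟫_ℂ).re := by
    rw [inner_smul_right, inner_add_left]
    simp
    ring
  have h4 : ‖-(2 : ℂ) • h‖ ^ 2 = 4 * ‖h‖ ^ 2 := by
    rw [norm_smul]; simp; ring
  rw [h2, h3, h4] at h1
  have h5 := sq_nonneg ‖f + g + -(2 : ℂ) • h‖
  simp only [RCLike.re_to_complex] at h1
  linarith

/-! ### The three lines argument -/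

/-- A family `φᵢ` with `∑ᵢ |φᵢ⟩⟨φᵢ| ≤ R`, whose position and momentum densities are the finite
measures `ν` and `ν'`, of total mass `τ`. -/
structure IsDensityFamily {ι : Type*} (φ : ι → L2x n) (R τ : ℝ) (ν ν' : Measure (Rn n)) :
    Prop where
  nonneg : 0 ≤ R
  bessel : ∀ (I : Finset ι) (k : L2x n), ∑ i ∈ I, ‖⟪k, φ i⟫_ℂ‖ ^ 2 ≤ R * ‖k‖ ^ 2
  position : ν = Measure.sum fun i => vecMeasure (φ i)
  momentum : ν' = Measure.sum fun i => vecMeasure (fourierL2 n (φ i))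
  position_univ : ν univ = ENNReal.ofReal τ
  momentum_univ : ν' univ = ENNReal.ofReal τ
  mass_pos : 0 < τ

/-- A bounded nonnegative function `p ≤ M` with `p ≤ D` off the set `B` and `∫_B p ≤ a`. -/
structure IsCutoff {X : Type*} [MeasurableSpace X] (μ : Measure X) (p : X → ℝ) (B : Set X)
    (M D a : ℝ) : Prop where
  measurableSet : MeasurableSet B
  nonneg : ∀ x, 0 ≤ p x
  le : ∀ x, p x ≤ M
  le_off : ∀ x ∉ B, p x ≤ D
  integrableOn : IntegrableOn p B μ
  setIntegral_le : ∫ x in B, p x ∂μ ≤ a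

section ThreeLines

variable {ι : Type*} {φ : ι → L2x n} {R τ : ℝ} {ν ν' : Measure (Rn n)}
  {p q : SimpleFunc (Rn n) ℝ} {B B' : Set (Rn n)} {M D a M' D' b : ℝ}

theorem vecMeasure_univ {X : Type*} [MeasurableSpace X] {μ : Measure X} (f : Lp ℂ 2 μ) :
    vecMeasure f univ = ENNReal.ofReal (‖f‖ ^ 2) := by
  rw [vecMeasure, withDensity_apply _ MeasurableSet.univ, setLIntegral_univ, ← integral_norm_sq,
    ofReal_integral_eq_lintegral_ofReal ((Lp.memLp f).integrable_norm_pow (by norm_num))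
      (Eventually.of_forall fun x => by positivity)]
  refine lintegral_congr fun x => ?_
  rw [ENNReal.ofReal_pow (norm_nonneg _), ofReal_norm]

theorem IsDensityFamily.sum_norm_sq_le (hφ : IsDensityFamily φ R τ ν ν') (I : Finset ι) :
    ∑ i ∈ I, ‖φ i‖ ^ 2 ≤ τ := by
  have h := hφ.position_univ
  rw [hφ.position, Measure.sum_apply _ MeasurableSet.univ] at h
  simp_rw [vecMeasure_univ] at h
  rw [← ENNReal.ofReal_le_ofReal_iff hφ.mass_pos.le,
    ENNReal.ofReal_sum_of_nonneg fun i _ => by positivity, ← h]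
  exact ENNReal.sum_le_tsum I

/-- The analytic function `∑ᵢ ⟨φᵢ, p^z F⁻¹ q^z F φᵢ⟩`. -/
def interpolant (φ : ι → L2x n) (p q : SimpleFunc (Rn n) ℝ) (I : Finset ι) (z : ℂ) : ℂ :=
  ∑ i ∈ I, ⟪powVec p ((starRingEnd ℂ) z) (φ i),
    (fourierL2 n).symm (powVec q z (fourierL2 n (φ i)))⟫_ℂ

/-- For simple `p`, `q` and finite `I` everything expands into a finite sum of exponentials in `z`
with constant coefficients. -/
theorem differentiable_interpolant (φ : ι → L2x n) (p q : SimpleFunc (Rn n) ℝ) (I : Finset ι) :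
    Differentiable ℂ (interpolant φ p q I) := by
  unfold interpolant powVec
  simp_rw [map_sum, map_smul, sum_inner, inner_sum, inner_smul_left, inner_smul_right,
    conj_cpowZero_conj]
  have h := differentiable_cpowZero
  fun_prop

/-- The value on the line `Re z = 1/2`. -/
def halfBound (R τ M D a M' D' b : ℝ) : ℝ :=
  √(R * b) * (√a * √τ) + τ * (√D * √M' + √M * √D')

theorem sum_norm_inner_le (hφ : IsDensityFamily φ R τ ν ν') (I : Finset ι) {f : ι → L2x n}
    {g : ι → L2xi n} {c c' : ℝ} (hc0 : 0 ≤ c) (hf : ∀ i, ‖f i‖ ≤ c * ‖φ i‖)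
    (hc0' : 0 ≤ c') (hg : ∀ i, ‖g i‖ ≤ c' * ‖fourierL2 n (φ i)‖) :
    ‖∑ i ∈ I, ⟪f i, (fourierL2 n).symm (g i)⟫_ℂ‖ ≤ τ * (c * c') := by
  refine (norm_sum_le _ _).trans ?_
  calc ∑ i ∈ I, ‖⟪f i, (fourierL2 n).symm (g i)⟫_ℂ‖
      ≤ ∑ i ∈ I, (c * ‖φ i‖) * (c' * ‖φ i‖) := by
        refine Finset.sum_le_sum fun i _ => (norm_inner_le_norm _ _).trans ?_
        have h1 := hf i
        have h2 := hg i
        rw [LinearIsometryEquiv.norm_map] at h2 ⊢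
        gcongr
    _ = (∑ i ∈ I, ‖φ i‖ ^ 2) * (c * c') := by
        rw [Finset.sum_mul]
        exact Finset.sum_congr rfl fun i _ => by ring
    _ ≤ τ * (c * c') := by
        gcongr
        exact hφ.sum_norm_sq_le I

theorem norm_interpolant_le (hφ : IsDensityFamily φ R τ ν ν') (I : Finset ι) {z : ℂ} {c c' : ℝ}
    (hc0 : 0 ≤ c) (hc0' : 0 ≤ c') (hc : ∀ x, ‖cpowZero ((starRingEnd ℂ) z) (p x)‖ ≤ c)
    (hc' : ∀ ξ, ‖cpowZero z (q ξ)‖ ≤ c') : ‖interpolant φ p q I z‖ ≤ τ * (c * c') :=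
  sum_norm_inner_le hφ I hc0 (fun i => norm_powVec_le p _ (φ i) hc) hc0'
    fun i => norm_powVec_le q _ (fourierL2 n (φ i)) hc'

theorem memLp_indicator_cpowZero {X : Type*} [MeasurableSpace X] {μ : Measure X}
    {p : SimpleFunc X ℝ} {B : Set X} (hp : IsCutoff μ p B M D a) {z : ℂ} (hz : z.re = 1 / 2) :
    MemLp (B.indicator fun x => cpowZero z (p x)) 2 μ ∧
      ∫ x, ‖B.indicator (fun x => cpowZero z (p x)) x‖ ^ 2 ∂μ ≤ a := by
  have h1 : (fun x => ‖B.indicator (fun x => cpowZero z (p x)) x‖ ^ 2) = B.indicator p := by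
    funext x
    by_cases hx : x ∈ B
    · rw [indicator_of_mem hx, indicator_of_mem hx, norm_cpowZero_half hz (hp.nonneg x),
        Real.sq_sqrt (hp.nonneg x)]
    · simp [indicator_of_notMem hx]
  have hm : AEStronglyMeasurable (B.indicator fun x => cpowZero z (p x)) μ :=
    ((p.map (cpowZero z)).aestronglyMeasurable).indicator hp.measurableSet
  refine ⟨(memLp_two_iff_integrable_sq_norm hm).2 ?_, ?_⟩
  · rw [h1, integrable_indicator_iff hp.measurableSet]
    exact hp.integrableOn
  · rw [h1, integral_indicator hp.measurableSet]
    exact hp.setIntegral_le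

/-- Split `⟨f, g⟩ = ⟨f₁, g₁⟩ + ⟨f₂, g⟩ + ⟨f₁, g₂⟩` along `B` and `B'`. The first term has square
integrable multipliers and obeys the Hilbert-Schmidt estimate; the others are bounded by sup norms,
with `D` or `D'` controlling the factor off the set. -/
theorem norm_interpolant_half_le (hφ : IsDensityFamily φ R τ ν ν')
    (hp : IsCutoff volume p B M D a) (hq : IsCutoff (volStar n) q B' M' D' b) (I : Finset ι)
    {z : ℂ} (hz : z.re = 1 / 2) :
    ‖interpolant φ p q I z‖ ≤ halfBound R τ M D a M' D' b := by
  have hz' : ((starRingEnd ℂ) z).re = 1 / 2 := by simpa using hz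
  set f : ι → L2x n := fun i => powVec p ((starRingEnd ℂ) z) (φ i) with hf
  set g : ι → L2xi n := fun i => powVec q z (fourierL2 n (φ i)) with hg
  set f₁ : ι → L2x n := fun i => chi _ B hp.measurableSet (f i) with hf₁
  set f₂ : ι → L2x n := fun i => chi _ Bᶜ hp.measurableSet.compl (f i) with hf₂
  set g₁ : ι → L2xi n := fun i => chi _ B' hq.measurableSet (g i) with hg₁
  set g₂ : ι → L2xi n := fun i => chi _ B'ᶜ hq.measurableSet.compl (g i) with hg₂
  have hsplit : interpolant φ p q I z = ∑ i ∈ I, ⟪f₁ i, (fourierL2 n).symm (g₁ i)⟫_ℂ +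
      (∑ i ∈ I, ⟪f₂ i, (fourierL2 n).symm (g i)⟫_ℂ +
        ∑ i ∈ I, ⟪f₁ i, (fourierL2 n).symm (g₂ i)⟫_ℂ) := by
    rw [← Finset.sum_add_distrib, ← Finset.sum_add_distrib]
    refine Finset.sum_congr rfl fun i _ => ?_
    have h1 : f₁ i + f₂ i = f i := chi_add_chi_compl hp.measurableSet (f i)
    have h2 : g₁ i + g₂ i = g i := chi_add_chi_compl hq.measurableSet (g i)
    change ⟪f i, (fourierL2 n).symm (g i)⟫_ℂ = _
    rw [← h1, inner_add_left, ← h2, map_add, inner_add_right, inner_add_right]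
    ring
  have hpM : ∀ x, ‖cpowZero ((starRingEnd ℂ) z) (p x)‖ ≤ √M := fun x => by
    rw [norm_cpowZero_half hz' (hp.nonneg x)]
    exact Real.sqrt_le_sqrt (hp.le x)
  have hpD : ∀ x ∈ Bᶜ, ‖cpowZero ((starRingEnd ℂ) z) (p x)‖ ≤ √D := fun x hx => by
    rw [norm_cpowZero_half hz' (hp.nonneg x)]
    exact Real.sqrt_le_sqrt (hp.le_off x hx)
  have hqM : ∀ x, ‖cpowZero z (q x)‖ ≤ √M' := fun x => by
    rw [norm_cpowZero_half hz (hq.nonneg x)]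
    exact Real.sqrt_le_sqrt (hq.le x)
  have hqD : ∀ x ∈ B'ᶜ, ‖cpowZero z (q x)‖ ≤ √D' := fun x hx => by
    rw [norm_cpowZero_half hz (hq.nonneg x)]
    exact Real.sqrt_le_sqrt (hq.le_off x hx)
  have hP := memLp_indicator_cpowZero hp hz'
  have hQ := memLp_indicator_cpowZero hq hz
  have b1 := norm_sum_inner_fourierL2_symm_le hφ.nonneg I (hφ.bessel I) (hφ.sum_norm_sq_le I)
    hP.1 hP.2 hQ.1 hQ.2 (f := f₁) (g := g₁)
    (fun i => by
      filter_upwards [coeFn_chi volume B hp.measurableSet (f i),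
        coeFn_powVec p ((starRingEnd ℂ) z) (φ i)] with x h1 h2
      rw [hf₁, h1]
      by_cases hx : x ∈ B
      · rw [indicator_of_mem hx, indicator_of_mem hx, hf, h2]
      · rw [indicator_of_notMem hx, indicator_of_notMem hx, zero_mul])
    (fun i => by
      filter_upwards [coeFn_chi (volStar n) B' hq.measurableSet (g i),
        coeFn_powVec q z (fourierL2 n (φ i))] with x h1 h2
      rw [hg₁, h1]
      by_cases hx : x ∈ B'
      · rw [indicator_of_mem hx, indicator_of_mem hx, hg, h2]
      · rw [indicator_of_notMem hx, indicator_of_notMem hx, zero_mul])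
  have b2 := sum_norm_inner_le hφ I (f := f₂) (g := g) (Real.sqrt_nonneg D)
    (fun i => norm_chi_powVec_le p _ (φ i) hp.measurableSet.compl (Real.sqrt_nonneg D) hpD)
    (Real.sqrt_nonneg M') (fun i => norm_powVec_le q _ _ hqM)
  have b3 := sum_norm_inner_le hφ I (f := f₁) (g := g₂) (Real.sqrt_nonneg M)
    (fun i => norm_chi_powVec_le p _ (φ i) hp.measurableSet (Real.sqrt_nonneg M) fun x _ => hpM x)
    (Real.sqrt_nonneg D') (fun i => norm_chi_powVec_le q _ _ hq.measurableSet.compl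
      (Real.sqrt_nonneg D') hqD)
  rw [hsplit, halfBound, mul_add]
  exact (norm_add_le _ _).trans (add_le_add b1 ((norm_add_le _ _).trans (add_le_add b2 b3)))

theorem norm_interpolant_ofReal_le (hφ : IsDensityFamily φ R τ ν ν')
    (hp : IsCutoff volume p B M D a) (hq : IsCutoff (volStar n) q B' M' D' b) (I : Finset ι)
    {s : ℝ} (hs0 : 0 ≤ s) (hs : s ≤ 1 / 2) :
    ‖interpolant φ p q I s‖ ≤
      τ ^ (1 - 2 * s) * halfBound R τ M D a M' D' b ^ (2 * s) := by
  have hM : 0 ≤ 1 + M := by have := (hp.nonneg 0).trans (hp.le 0); linarith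
  have hM' : 0 ≤ 1 + M' := by have := (hq.nonneg 0).trans (hq.le 0); linarith
  have h := Complex.HadamardThreeLines.norm_le_interp_of_mem_verticalClosedStrip'
    (f := interpolant φ p q I) (z := s) (a := τ) (b := halfBound R τ M D a M' D' b)
    (l := 0) (u := 1 / 2) (by norm_num)
    (by simpa [Complex.HadamardThreeLines.verticalClosedStrip] using ⟨hs0, by linarith⟩)
    (differentiable_interpolant φ p q I).diffContOnCl
    ⟨τ * ((1 + M) * (1 + M')), by
      rintro _ ⟨z, hz, rfl⟩
      have hz' : 0 ≤ z.re ∧ z.re ≤ 1 / 2 := hz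
      refine norm_interpolant_le hφ I hM hM'
        (fun x => norm_cpowZero_le ?_ ?_ (hp.nonneg x) (hp.le x))
        (fun x => norm_cpowZero_le ?_ ?_ (hq.nonneg x) (hq.le x))
      · simpa using hz'.1
      · rw [Complex.conj_re]; linarith [hz'.2]
      · exact hz'.1
      · linarith [hz'.2]⟩
    (fun z hz => by
      have hz : z.re = 0 := hz
      have := norm_interpolant_le hφ I zero_le_one zero_le_one
        (fun x => norm_cpowZero_le_one (z := (starRingEnd ℂ) z) (by simpa using hz) (hp.nonneg x))
        (fun x => norm_cpowZero_le_one hz (hq.nonneg x))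
      simpa using this)
    (fun z hz => norm_interpolant_half_le hφ hp hq I hz)
  convert h using 3 <;> simp <;> ring

theorem sum_integral_le_norm_interpolant {s : ℝ} (hs : s ≠ 0) (hp : ∀ x, 0 ≤ p x)
    (hq : ∀ x, 0 ≤ q x) (φ : ι → L2x n) (I : Finset ι) :
    ∑ i ∈ I, (∫ x, (2 * p x ^ s - (p x ^ s) ^ 2 / 2 - 1) ∂(vecMeasure (φ i)) +
      ∫ ξ, (2 * q ξ ^ s - (q ξ ^ s) ^ 2 / 2 - 1) ∂(vecMeasure (fourierL2 n (φ i)))) ≤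
      ‖interpolant φ p q I s‖ := by
  refine le_trans ?_ (Complex.re_le_norm _)
  rw [interpolant, Complex.re_sum]
  refine Finset.sum_le_sum fun i _ => ?_
  rw [integral_powVec p hp hs, integral_powVec q hq hs, Complex.conj_ofReal]
  have h := re_inner_lower_bound (powVec p s (φ i))
    ((fourierL2 n).symm (powVec q s (fourierL2 n (φ i)))) (φ i)
  have h1 : ⟪(fourierL2 n).symm (powVec q s (fourierL2 n (φ i))), φ i⟫_ℂ =
      ⟪powVec q s (fourierL2 n (φ i)), fourierL2 n (φ i)⟫_ℂ := by
    rw [← (fourierL2 n).inner_map_map, LinearIsometryEquiv.apply_symm_apply]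
  rw [h1, LinearIsometryEquiv.norm_map] at h
  rwa [LinearIsometryEquiv.norm_map]

theorem integrable_simpleFunc_comp {X : Type*} [MeasurableSpace X] {μ : Measure X}
    [IsFiniteMeasure μ] (p : SimpleFunc X ℝ) (h : ℝ → ℝ) : Integrable (fun x => h (p x)) μ := by
  have := SimpleFunc.integrable_of_isFiniteMeasure (μ := μ) (p.map h)
  rwa [SimpleFunc.coe_map] at this

/-- The interpolation inequality for simple functions. -/
theorem integral_simpleFunc_le (hφ : IsDensityFamily φ R τ ν ν')
    (hp : IsCutoff volume p B M D a) (hq : IsCutoff (volStar n) q B' M' D' b)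
    {s : ℝ} (hs0 : 0 < s) (hs : s ≤ 1 / 2) :
    ∫ x, (2 * p x ^ s - (p x ^ s) ^ 2 / 2 - 1) ∂ν +
      ∫ ξ, (2 * q ξ ^ s - (q ξ ^ s) ^ 2 / 2 - 1) ∂ν' ≤
      τ ^ (1 - 2 * s) * halfBound R τ M D a M' D' b ^ (2 * s) := by
  have hf : IsFiniteMeasure ν := ⟨by rw [hφ.position_univ]; exact ENNReal.ofReal_lt_top⟩
  have hf' : IsFiniteMeasure ν' := ⟨by rw [hφ.momentum_univ]; exact ENNReal.ofReal_lt_top⟩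
  have h1 : Integrable (fun x => 2 * p x ^ s - (p x ^ s) ^ 2 / 2 - 1) ν :=
    integrable_simpleFunc_comp p fun t : ℝ => 2 * t ^ s - (t ^ s) ^ 2 / 2 - 1
  have h2 : Integrable (fun x => 2 * q x ^ s - (q x ^ s) ^ 2 / 2 - 1) ν' :=
    integrable_simpleFunc_comp q fun t : ℝ => 2 * t ^ s - (t ^ s) ^ 2 / 2 - 1
  have h3 := h1
  have h4 := h2
  rw [hφ.position] at h3
  rw [hφ.momentum] at h4
  have h5 := (hasSum_integral_measure h3).add (hasSum_integral_measure h4)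
  rw [← hφ.position, ← hφ.momentum] at h5
  -- The bound does not depend on the finite set `I`, so it passes to the sum over the whole family.
  refine hasSum_le_of_sum_le h5 fun I => ?_
  exact (sum_integral_le_norm_interpolant hs0.ne' hp.nonneg hq.nonneg φ I).trans
    (norm_interpolant_ofReal_le hφ hp hq I hs0.le hs)

end ThreeLines

/-! ### From simple functions to measurable functions -/

theorem abs_two_mul_sub_le {t N : ℝ} (h0 : 0 ≤ t) (h1 : t ≤ N) :
    ‖2 * t - t ^ 2 / 2 - 1‖ ≤ 2 * N + N ^ 2 + 1 := by
  rw [Real.norm_eq_abs, abs_le]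
  constructor <;> nlinarith

theorem rpow_le_one_add {a M s : ℝ} (ha : 0 ≤ a) (haM : a ≤ M) (h0 : 0 ≤ s) (h1 : s ≤ 1) :
    a ^ s ≤ 1 + M := by
  rcases le_total a 1 with h | h
  · exact (Real.rpow_le_one ha h h0).trans (by linarith)
  · exact (Real.rpow_le_rpow_of_exponent_le h h1).trans (by rw [Real.rpow_one]; linarith)

section Approximation

variable {X : Type*} [MeasurableSpace X] {μ : Measure X} {p : X → ℝ} {B : Set X} {M D a : ℝ}

/-- Nonnegative simple functions increasing to `p ≥ 0`. -/
def simpleApprox (p : X → ℝ) (k : ℕ) : SimpleFunc X ℝ :=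
  (SimpleFunc.eapprox (fun x => ENNReal.ofReal (p x)) k).map ENNReal.toReal

theorem simpleApprox_nonneg (p : X → ℝ) (k : ℕ) (x : X) : 0 ≤ simpleApprox p k x := by
  simp [simpleApprox]

theorem simpleApprox_le (hm : Measurable p) (hp : ∀ x, 0 ≤ p x) (k : ℕ) (x : X) :
    simpleApprox p k x ≤ p x := by
  simp only [simpleApprox, SimpleFunc.map_apply]
  refine ENNReal.toReal_le_of_le_ofReal (hp x) ?_
  rw [← SimpleFunc.iSup_eapprox_apply hm.ennreal_ofReal x]
  exact le_iSup (fun k => SimpleFunc.eapprox (fun x => ENNReal.ofReal (p x)) k x) k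

theorem tendsto_simpleApprox (hm : Measurable p) (hp : ∀ x, 0 ≤ p x) (x : X) :
    Tendsto (fun k => simpleApprox p k x) atTop (𝓝 (p x)) := by
  have h := SimpleFunc.tendsto_eapprox hm.ennreal_ofReal x
  have h2 := (ENNReal.tendsto_toReal ENNReal.ofReal_ne_top).comp h
  rwa [ENNReal.toReal_ofReal (hp x)] at h2

theorem IsCutoff.simpleApprox (hp : IsCutoff μ p B M D a) (hm : Measurable p) (k : ℕ) :
    IsCutoff μ (simpleApprox p k) B M D a where
  measurableSet := hp.measurableSet
  nonneg := simpleApprox_nonneg p k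
  le x := (simpleApprox_le hm hp.nonneg k x).trans (hp.le x)
  le_off x hx := (simpleApprox_le hm hp.nonneg k x).trans (hp.le_off x hx)
  integrableOn := hp.integrableOn.mono' (SimpleFunc.aestronglyMeasurable _)
    (Eventually.of_forall fun x => by
      rw [Real.norm_of_nonneg (simpleApprox_nonneg p k x)]
      exact simpleApprox_le hm hp.nonneg k x)
  setIntegral_le :=
    le_trans (integral_mono_of_nonneg (Eventually.of_forall (simpleApprox_nonneg p k))
      hp.integrableOn (Eventually.of_forall (simpleApprox_le hm hp.nonneg k))) hp.setIntegral_le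

theorem tendsto_integral_simpleApprox {ν : Measure X} [IsFiniteMeasure ν]
    (hp : IsCutoff μ p B M D a) (hm : Measurable p) {s : ℝ} (hs0 : 0 < s) (hs1 : s ≤ 1) :
    Tendsto (fun k => ∫ x, (2 * FourierEntropy.simpleApprox p k x ^ s -
      (FourierEntropy.simpleApprox p k x ^ s) ^ 2 / 2 - 1) ∂ν) atTop
      (𝓝 (∫ x, (2 * p x ^ s - (p x ^ s) ^ 2 / 2 - 1) ∂ν)) := by
  refine tendsto_integral_of_dominated_convergence
    (fun _ => 2 * (1 + M) + (1 + M) ^ 2 + 1) (fun k => ?_) (integrable_const _)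
    (fun k => Eventually.of_forall fun x => ?_) (Eventually.of_forall fun x => ?_)
  · exact ((FourierEntropy.simpleApprox p k).map
      fun t : ℝ => 2 * t ^ s - (t ^ s) ^ 2 / 2 - 1).aestronglyMeasurable
  · have h := (hp.simpleApprox hm k)
    exact abs_two_mul_sub_le (Real.rpow_nonneg (h.nonneg x) s)
      (rpow_le_one_add (h.nonneg x) (h.le x) hs0.le hs1)
  · have h := (tendsto_simpleApprox hm hp.nonneg x).rpow_const (p := s) (Or.inr hs0.le)
    exact ((h.const_mul 2).sub ((h.pow 2).div_const 2)).sub_const 1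

end Approximation

/-! ### Differentiation at `s = 0` -/

theorem tendsto_rpow_sub_one_div {a : ℝ} (ha : 0 < a) :
    Tendsto (fun s : ℝ => (a ^ s - 1) / s) (𝓝[>] 0) (𝓝 (Real.log a)) := by
  have h := (Real.hasStrictDerivAt_const_rpow ha 0).hasDerivAt.tendsto_slope_zero_right
  simp only [zero_add, Real.rpow_zero, one_mul, smul_eq_mul] at h
  simpa only [div_eq_inv_mul] using h

/-- With `y = s ln a` this is `|e^y - 1| ≤ |y| max(1, e^y)`. After division by `s` it gives a
majorant independent of `s`. -/
theorem abs_rpow_sub_one_le {a M s : ℝ} (ha : 0 < a) (haM : a ≤ M) (h0 : 0 < s) (h1 : s ≤ 1) :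
    |a ^ s - 1| ≤ s * |Real.log a| * (1 + M) := by
  have hM := rpow_le_one_add ha.le haM h0.le h1
  have hs : s * |Real.log a| = |Real.log a * s| := by rw [abs_mul, abs_of_pos h0, mul_comm]
  rw [hs]
  rw [Real.rpow_def_of_pos ha] at hM ⊢
  set y := Real.log a * s
  have hy := Real.exp_pos y
  rcases le_total y 0 with h | h
  · have := Real.add_one_le_exp y
    have h3 : Real.exp y ≤ 1 := Real.exp_le_one_iff.2 h
    rw [abs_of_nonpos (by linarith), abs_of_nonpos h]
    nlinarith
  · have h2 := Real.add_one_le_exp (-y)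
    have h3 : 1 ≤ Real.exp y := Real.one_le_exp h
    have h4 : Real.exp y * Real.exp (-y) = 1 := by rw [← Real.exp_add]; simp
    rw [abs_of_nonneg (by linarith), abs_of_nonneg h]
    nlinarith

/-- Dominated convergence with a constant multiple of `|ln p|`; the quadratic term is a difference
quotient times a factor tending to `0`. -/
theorem tendsto_integral_rpow_sub_one {X : Type*} [MeasurableSpace X] {ν : Measure X}
    {p : X → ℝ} {M : ℝ} (hm : Measurable p) (hpos : ∀ᵐ x ∂ν, 0 < p x) (hM : ∀ x, p x ≤ M)
    (hM0 : 0 ≤ M) (hlog : Integrable (fun x => Real.log (p x)) ν) :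
    Tendsto (fun s : ℝ => ∫ x, ((p x ^ s - 1) - (p x ^ s - 1) ^ 2 / 2) / s ∂ν) (𝓝[>] 0)
      (𝓝 (∫ x, Real.log (p x) ∂ν)) := by
  have hsmall : ∀ᶠ s : ℝ in 𝓝[>] 0, 0 < s ∧ s ≤ 1 := by
    filter_upwards [Ioc_mem_nhdsGT (zero_lt_one (α := ℝ))] with s hs using hs
  refine tendsto_integral_filter_of_dominated_convergence
    (fun x => |Real.log (p x)| * ((1 + M) * (1 + (2 + M)))) ?_ ?_ (hlog.abs.mul_const _) ?_
  · refine Eventually.of_forall fun s => Measurable.aestronglyMeasurable ?_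
    fun_prop
  · filter_upwards [hsmall] with s hs
    filter_upwards [hpos] with x hx
    have h1 := abs_rpow_sub_one_le hx (hM x) hs.1 hs.2
    have h2 := rpow_le_one_add hx.le (hM x) hs.1.le hs.2
    have h3 := Real.rpow_nonneg hx.le s
    have h4 : |p x ^ s - 1| ≤ 2 + M := by rw [abs_le]; constructor <;> linarith
    rw [Real.norm_eq_abs, abs_div, abs_of_pos hs.1, div_le_iff₀ hs.1]
    set t := p x ^ s - 1
    calc |t - t ^ 2 / 2| ≤ |t| + |t ^ 2 / 2| := abs_sub _ _
      _ = |t| * (1 + |t| / 2) := by rw [abs_div, abs_pow, abs_two]; ring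
      _ ≤ (s * |Real.log (p x)| * (1 + M)) * (1 + (2 + M)) := by
        exact mul_le_mul h1 (by linarith [abs_nonneg t]) (by positivity)
          ((abs_nonneg _).trans h1)
      _ = _ := by ring
  · filter_upwards [hpos] with x hx
    have h1 := tendsto_rpow_sub_one_div hx
    have h2 : Tendsto (fun s : ℝ => p x ^ s - 1) (𝓝[>] 0) (𝓝 0) := by
      have : Tendsto (fun s : ℝ => p x ^ s) (𝓝[>] 0) (𝓝 (p x ^ (0 : ℝ))) :=
        ((Real.continuous_const_rpow hx.ne').tendsto 0).mono_left nhdsWithin_le_nhds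
      simpa using this.sub_const 1
    have h3 := h1.sub ((h1.mul h2).div_const 2)
    simp only [mul_zero, zero_div, sub_zero] at h3
    refine h3.congr fun s => ?_
    ring

section Derivative

variable {ι : Type*} {φ : ι → L2x n} {R τ : ℝ} {ν ν' : Measure (Rn n)}
  {p q : Rn n → ℝ} {B B' : Set (Rn n)} {M D a M' D' b : ℝ}

theorem integral_cutoff_le (hφ : IsDensityFamily φ R τ ν ν')
    (hp : IsCutoff volume p B M D a) (hq : IsCutoff (volStar n) q B' M' D' b)
    (hpm : Measurable p) (hqm : Measurable q) {s : ℝ} (hs0 : 0 < s) (hs : s ≤ 1 / 2) :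
    ∫ x, (2 * p x ^ s - (p x ^ s) ^ 2 / 2 - 1) ∂ν +
      ∫ ξ, (2 * q ξ ^ s - (q ξ ^ s) ^ 2 / 2 - 1) ∂ν' ≤
      τ ^ (1 - 2 * s) * halfBound R τ M D a M' D' b ^ (2 * s) := by
  have hf : IsFiniteMeasure ν := ⟨by rw [hφ.position_univ]; exact ENNReal.ofReal_lt_top⟩
  have hf' : IsFiniteMeasure ν' := ⟨by rw [hφ.momentum_univ]; exact ENNReal.ofReal_lt_top⟩
  exact le_of_tendsto ((tendsto_integral_simpleApprox hp hpm hs0 (by linarith)).add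
    (tendsto_integral_simpleApprox hq hqm hs0 (by linarith)))
    (Eventually.of_forall fun k => integral_simpleFunc_le hφ (hp.simpleApprox hpm k)
      (hq.simpleApprox hqm k) hs0 hs)

/-- With `t = 1 + u` one has `2t - t²/2 - 1 = 1/2 + (u - u²/2)`. -/
theorem integral_eq_half_add {X : Type*} [MeasurableSpace X] {μ ν : Measure X} {p : X → ℝ}
    {B : Set X} [IsFiniteMeasure ν] (hp : IsCutoff μ p B M D a) (hm : Measurable p)
    (hτ : 0 ≤ τ) (hν : ν univ = ENNReal.ofReal τ) {s : ℝ} (hs0 : 0 < s) (hs : s ≤ 1) :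
    ∫ x, (2 * p x ^ s - (p x ^ s) ^ 2 / 2 - 1) ∂ν =
      τ / 2 + s * ∫ x, ((p x ^ s - 1) - (p x ^ s - 1) ^ 2 / 2) / s ∂ν := by
  have hr : ν.real univ = τ := by rw [Measure.real, hν, ENNReal.toReal_ofReal hτ]
  have hint : Integrable (fun x => 2 * p x ^ s - (p x ^ s) ^ 2 / 2 - 1) ν := by
    refine Integrable.of_bound (C := 2 * (1 + M) + (1 + M) ^ 2 + 1) ?_
      (Eventually.of_forall fun x => abs_two_mul_sub_le (Real.rpow_nonneg (hp.nonneg x) s)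
        (rpow_le_one_add (hp.nonneg x) (hp.le x) hs0.le hs))
    exact Measurable.aestronglyMeasurable (by fun_prop)
  have h1 : ∀ x, (p x ^ s - 1) - (p x ^ s - 1) ^ 2 / 2 =
      (2 * p x ^ s - (p x ^ s) ^ 2 / 2 - 1) - 1 / 2 := fun x => by ring
  rw [integral_div, mul_div_cancel₀ _ hs0.ne']
  simp_rw [h1]
  rw [integral_sub hint (integrable_const _), integral_const, hr, smul_eq_mul]
  ring

/-- The entropic uncertainty relation, for truncated densities: the derivative at `s = 0` of the
interpolation inequality. -/
theorem integral_log_add_integral_log_le (hφ : IsDensityFamily φ R τ ν ν')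
    (hp : IsCutoff volume p B M D a) (hq : IsCutoff (volStar n) q B' M' D' b)
    (hpm : Measurable p) (hqm : Measurable q) (hp0 : ∀ᵐ x ∂ν, 0 < p x) (hq0 : ∀ᵐ x ∂ν', 0 < q x)
    (hpl : Integrable (fun x => Real.log (p x)) ν)
    (hql : Integrable (fun x => Real.log (q x)) ν')
    (hC : 0 < halfBound R τ M D a M' D' b) :
    ∫ x, Real.log (p x) ∂ν + ∫ ξ, Real.log (q ξ) ∂ν' ≤
      τ * (2 * Real.log (halfBound R τ M D a M' D' b / τ)) := by
  have hf : IsFiniteMeasure ν := ⟨by rw [hφ.position_univ]; exact ENNReal.ofReal_lt_top⟩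
  have hf' : IsFiniteMeasure ν' := ⟨by rw [hφ.momentum_univ]; exact ENNReal.ofReal_lt_top⟩
  have hM : 0 ≤ M := (hp.nonneg 0).trans (hp.le 0)
  have hM' : 0 ≤ M' := (hq.nonneg 0).trans (hq.le 0)
  set C := halfBound R τ M D a M' D' b
  have hτ := hφ.mass_pos
  have hr : 0 < (C / τ) ^ 2 := by positivity
  have h1 := (tendsto_integral_rpow_sub_one hpm hp0 hp.le hM hpl).add
    (tendsto_integral_rpow_sub_one hqm hq0 hq.le hM' hql)
  have h2 := (tendsto_rpow_sub_one_div hr).const_mul τ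
  rw [Real.log_pow, Nat.cast_ofNat] at h2
  refine le_of_tendsto_of_tendsto h1 h2 ?_
  filter_upwards [Ioc_mem_nhdsGT (show (0 : ℝ) < 1 / 2 by norm_num)] with s hs
  have h3 := integral_cutoff_le hφ hp hq hpm hqm hs.1 hs.2
  -- The two halves `τ / 2` add up to the value at `s = 0` of the right side `τ ((C / τ)²)^s`.
  -- Subtracting it and dividing by `s` leaves difference quotients on both sides.
  rw [integral_eq_half_add hp hpm hτ.le hφ.position_univ hs.1 (by linarith [hs.2]),
    integral_eq_half_add hq hqm hτ.le hφ.momentum_univ hs.1 (by linarith [hs.2])] at h3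
  have h4 : τ ^ (1 - 2 * s) * C ^ (2 * s) = τ * ((C / τ) ^ 2) ^ s := by
    rw [← Real.rpow_natCast, ← Real.rpow_mul (by positivity), Nat.cast_ofNat,
      Real.div_rpow hC.le hτ.le, Real.rpow_sub hτ, Real.rpow_one]
    ring
  change _ ≤ τ ^ (1 - 2 * s) * C ^ (2 * s) at h3
  rw [h4] at h3
  rw [← mul_div_assoc, le_div_iff₀ hs.1]
  linarith

end Derivative

/-! ### The density measures of a state -/

theorem vecMeasure_apply {X : Type*} [MeasurableSpace X] {μ : Measure X} (f : Lp ℂ 2 μ)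
    {Ω : Set X} (hΩ : MeasurableSet Ω) : vecMeasure f Ω = ENNReal.ofReal (‖chi μ Ω hΩ f‖ ^ 2) := by
  rw [← vecMeasure_univ, vecMeasure, vecMeasure, withDensity_apply _ hΩ,
    withDensity_apply _ MeasurableSet.univ, setLIntegral_univ, ← lintegral_indicator hΩ]
  refine lintegral_congr_ae ?_
  filter_upwards [coeFn_chi μ Ω hΩ f] with x hx
  rw [hx]
  by_cases h : x ∈ Ω <;> simp [h]

/-- The density measure may be computed in any Hilbert basis. -/
theorem nu_eq_sum_vecMeasure {X : Type*} [MeasurableSpace X] {μ : Measure X} {ι : Type*}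
    (b : HilbertBasis ι ℂ (Lp ℂ 2 μ)) (P : Lp ℂ 2 μ →L[ℂ] Lp ℂ 2 μ) :
    nu P = Measure.sum fun i => vecMeasure (opSqrt P (b i)) := by
  refine Measure.ext fun Ω hΩ => ?_
  rw [nu_apply P Ω hΩ, trace_sqrt_chi_sqrt, Measure.sum_apply _ hΩ]
  have h1 : ∀ f : Lp ℂ 2 μ, ∫⁻ x in Ω, ‖f x‖ₑ ^ 2 ∂μ = ENNReal.ofReal (‖chi μ Ω hΩ f‖ ^ 2) :=
    fun f => by rw [← vecMeasure_apply, vecMeasure, withDensity_apply _ hΩ]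
  simp_rw [h1, vecMeasure_apply _ hΩ]
  have h2 := tsum_sq_norm_adjoint (hilbertBasis (Lp ℂ 2 μ)) b (chi μ Ω hΩ ∘L opSqrt P)
  have h3 := tsum_sq_norm_adjoint b b (chi μ Ω hΩ ∘L opSqrt P)
  exact h2.trans h3.symm

theorem isPositive_hatOp {T : L2x n →L[ℂ] L2x n} (hT : T.IsPositive) : (hatOp T).IsPositive := by
  have h := hT.conj_adjoint (fourierL2 n : L2x n →L[ℂ] L2xi n)
  rwa [LinearIsometryEquiv.adjoint_eq_symm] at h

theorem opSqrt_comp_opSqrt {H : Type*} [NormedAddCommGroup H] [InnerProductSpace ℂ H]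
    [CompleteSpace H] {P : H →L[ℂ] H} (hP : P.IsPositive) : opSqrt P ∘L opSqrt P = P :=
  CFC.sqrt_mul_sqrt_self P ((ContinuousLinearMap.nonneg_iff_isPositive P).2 hP)

theorem opSqrt_eq_of_comp_self {H : Type*} [NormedAddCommGroup H] [InnerProductSpace ℂ H]
    [CompleteSpace H] {P Q : H →L[ℂ] H} (hQ : Q.IsPositive) (h : Q ∘L Q = P) : opSqrt P = Q :=
  CFC.sqrt_unique h ((ContinuousLinearMap.nonneg_iff_isPositive Q).2 hQ)

theorem opSqrt_hatOp {ρ : L2x n →L[ℂ] L2x n} (hρ : ρ.IsPositive) :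
    opSqrt (hatOp ρ) = hatOp (opSqrt ρ) := by
  refine opSqrt_eq_of_comp_self (isPositive_hatOp (opSqrt_isPositive ρ)) ?_
  ext1 g
  obtain ⟨f, rfl⟩ := (fourierL2 n).surjective g
  rw [ContinuousLinearMap.comp_apply, hatOp_fourierL2, hatOp_fourierL2, hatOp_fourierL2,
    ← ContinuousLinearMap.comp_apply, opSqrt_comp_opSqrt hρ]

/-- The density measure is independent of the basis, so it may be computed in the Fourier image of
`b`; the square root commutes with the unitary conjugation. -/
theorem nu_hatOp {ρ : L2x n →L[ℂ] L2x n} (hρ : ρ.IsPositive) {ι : Type*}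
    (b : HilbertBasis ι ℂ (L2x n)) :
    nu (hatOp ρ) = Measure.sum fun i => vecMeasure (fourierL2 n (opSqrt ρ (b i))) := by
  rw [nu_eq_sum_vecMeasure (HilbertBasis.ofRepr ((fourierL2 n).symm.trans b.repr)),
    opSqrt_hatOp hρ]
  refine congrArg Measure.sum (funext fun i => ?_)
  rw [← hatOp_fourierL2]
  congr 2

theorem nu_univ {ρ : L2x n →L[ℂ] L2x n} (hρ : ρ.IsPositive) : nu ρ univ = trace ρ := by
  rw [nu_eq_sum_vecMeasure (hilbertBasis (L2x n)), Measure.sum_apply _ MeasurableSet.univ, trace]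
  simp_rw [vecMeasure_univ, inner_opSqrt hρ]

theorem nu_hatOp_univ {ρ : L2x n →L[ℂ] L2x n} (hρ : ρ.IsPositive) :
    nu (hatOp ρ) univ = trace ρ := by
  rw [nu_hatOp hρ (hilbertBasis (L2x n)), Measure.sum_apply _ MeasurableSet.univ, trace]
  simp_rw [vecMeasure_univ, inner_opSqrt hρ, LinearIsometryEquiv.norm_map]

theorem IsState.isDensityFamily {ρ : L2x n →L[ℂ] L2x n} (hρ : IsState ρ) (h0 : trace ρ ≠ 0) :
    IsDensityFamily (fun i => opSqrt ρ (hilbertBasis (L2x n) i)) ‖ρ‖ (trace ρ).toReal (nu ρ)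
      (nu (hatOp ρ)) where
  nonneg := norm_nonneg ρ
  bessel I k := sum_sq_norm_inner_opSqrt_le hρ.isPositive (hilbertBasis (L2x n)).orthonormal I k
  position := nu_eq_sum_vecMeasure (hilbertBasis (L2x n)) ρ
  momentum := nu_hatOp hρ.isPositive (hilbertBasis (L2x n))
  position_univ := by rw [nu_univ hρ.isPositive, ENNReal.ofReal_toReal hρ.trace_ne_top]
  momentum_univ := by rw [nu_hatOp_univ hρ.isPositive, ENNReal.ofReal_toReal hρ.trace_ne_top]
  mass_pos := ENNReal.toReal_pos h0 hρ.trace_ne_top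

/-! ### Truncations of a probability density -/

section Truncation

variable {X : Type*} [MeasurableSpace X] {μ ν : Measure X} {τ : ℝ}

/-- The density `dν/dμ` as a real function. -/
def density (ν μ : Measure X) (x : X) : ℝ := (ν.rnDeriv μ x).toReal

theorem measurable_density : Measurable (density ν μ) :=
  (Measure.measurable_rnDeriv ν μ).ennreal_toReal

theorem density_nonneg (x : X) : 0 ≤ density ν μ x := ENNReal.toReal_nonneg

/-- Hence the defaults `Real.log 0 = 0` and `ENNReal.toReal ⊤ = 0` affect the entropy integrals only
on a `ν`-null set. -/
theorem density_pos [IsFiniteMeasure ν] [SigmaFinite μ] (h : ν ≪ μ) :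
    ∀ᵐ x ∂ν, 0 < density ν μ x := by
  filter_upwards [Measure.rnDeriv_pos h, h.ae_le (Measure.rnDeriv_lt_top ν μ)] with x h0 h1
  exact ENNReal.toReal_pos h0.ne' h1.ne

theorem integrable_density [IsFiniteMeasure ν] : Integrable (density ν μ) μ :=
  Measure.integrable_toReal_rnDeriv

theorem integral_density [IsFiniteMeasure ν] [SigmaFinite μ] (h : ν ≪ μ) (hτ : 0 ≤ τ)
    (hν : ν univ = ENNReal.ofReal τ) : ∫ x, density ν μ x ∂μ = τ := by
  refine (Measure.integral_toReal_rnDeriv h).trans ?_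
  rw [Measure.real, hν, ENNReal.toReal_ofReal hτ]

theorem isCutoff_min_density [IsFiniteMeasure ν] [SigmaFinite μ] (h : ν ≪ μ) (hτ : 0 ≤ τ)
    (hν : ν univ = ENNReal.ofReal τ) {N : ℝ} (hN : 0 ≤ N) :
    IsCutoff μ (fun x => min (density ν μ x) N) univ N 0 τ where
  measurableSet := MeasurableSet.univ
  nonneg x := le_min (density_nonneg x) hN
  le x := min_le_right _ _
  -- Nothing lies off `univ`, so `D = 0` is allowed and the corresponding error term in `halfBound`
  -- vanishes.
  le_off x hx := absurd (mem_univ x) hx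
  integrableOn := (integrable_density (ν := ν)).integrableOn.mono'
    (measurable_density.min measurable_const).aestronglyMeasurable
    (Eventually.of_forall fun x => by
      rw [Real.norm_of_nonneg (le_min (density_nonneg x) hN)]
      exact min_le_left _ _)
  setIntegral_le := by
    rw [setIntegral_univ, ← integral_density h hτ hν]
    exact integral_mono_of_nonneg (Eventually.of_forall fun x => le_min (density_nonneg x) hN)
      integrable_density (Eventually.of_forall fun x => min_le_left _ _)

/-- The logarithm of this cutoff is the positive part of `ln (dν/dμ)`, capped at `ln N`. Where the
density is at most `1` the cutoff equals `1`, which need not be integrable; this is what `B` and `D`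
are for. -/
theorem isCutoff_max_density [IsFiniteMeasure ν] [SigmaFinite μ] (h : ν ≪ μ) (hτ : 0 ≤ τ)
    (hν : ν univ = ENNReal.ofReal τ) {N : ℝ} (hN : 1 ≤ N) :
    IsCutoff μ (fun x => max 1 (min (density ν μ x) N)) {x | 1 < density ν μ x} N 1 τ := by
  have hB : MeasurableSet {x | 1 < density ν μ x} :=
    measurableSet_lt measurable_const measurable_density
  have h0 : ∀ x, 0 ≤ max 1 (min (density ν μ x) N) := fun x =>
    zero_le_one.trans (le_max_left _ _)
  have hle : ∀ᵐ x ∂μ.restrict {x | 1 < density ν μ x},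
      max 1 (min (density ν μ x) N) ≤ density ν μ x := by
    filter_upwards [ae_restrict_mem hB] with x hx
    exact max_le (le_of_lt hx) (min_le_left _ _)
  refine ⟨hB, h0, fun x => max_le hN (min_le_right _ _), fun x hx => ?_, ?_, ?_⟩
  · exact max_le le_rfl ((min_le_left _ _).trans (not_lt.1 hx))
  · refine (integrable_density (ν := ν)).integrableOn.mono'
      (measurable_const.max (measurable_density.min measurable_const)).aestronglyMeasurable ?_
    filter_upwards [hle] with x hx
    rwa [Real.norm_of_nonneg (h0 x)]
  · rw [← integral_density h hτ hν]
    refine (integral_mono_of_nonneg (Eventually.of_forall h0)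
      integrable_density.integrableOn hle).trans ?_
    exact setIntegral_le_integral integrable_density (Eventually.of_forall density_nonneg)

/-! ### Integrability and limits of logarithms of truncated densities -/

theorem enorm_log_min_one {u : ℝ} (hu : 0 ≤ u) :
    ‖Real.log (min u 1)‖ₑ = ENNReal.ofReal (-Real.log u) := by
  rw [← ofReal_norm, Real.norm_eq_abs]
  rcases le_total u 1 with h | h
  · rw [min_eq_left h, abs_of_nonpos (Real.log_nonpos hu h)]
  · rw [min_eq_right h, Real.log_one, abs_zero,
      ENNReal.ofReal_of_nonpos (neg_nonpos.2 (Real.log_nonneg h)), ENNReal.ofReal_zero]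

theorem integrable_log_min_one (h : entropyPos ν μ ≠ ⊤) :
    Integrable (fun x => Real.log (min (density ν μ x) 1)) ν := by
  refine ⟨(measurable_density.min measurable_const).log.aestronglyMeasurable, ?_⟩
  rw [HasFiniteIntegral]
  simp_rw [enorm_log_min_one (density_nonneg _)]
  exact lt_top_iff_ne_top.2 h

theorem integrable_log_max [IsFiniteMeasure ν] (N : ℝ) (hN : 1 ≤ N) :
    Integrable (fun x => Real.log (max 1 (min (density ν μ x) N))) ν := by
  refine Integrable.of_bound (C := Real.log N)
    (measurable_const.max (measurable_density.min measurable_const)).log.aestronglyMeasurable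
    (Eventually.of_forall fun x => ?_)
  rw [Real.norm_of_nonneg (Real.log_nonneg (le_max_left _ _))]
  exact Real.log_le_log (zero_lt_one.trans_le (le_max_left _ _)) (max_le hN (min_le_right _ _))

/-- Monotone convergence along `N = k + 1`; at each point the truncated logarithms are eventually
constant. -/
theorem entropyNeg_le_of_forall [IsFiniteMeasure ν] {K : ℝ}
    (hK : ∀ N : ℝ, 1 ≤ N → ∫ x, Real.log (max 1 (min (density ν μ x) N)) ∂ν ≤ K) :
    entropyNeg ν μ ≤ ENNReal.ofReal K := by
  have hlim : Tendsto (fun k : ℕ => ∫⁻ x,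
      ENNReal.ofReal (Real.log (max 1 (min (density ν μ x) (k + 1)))) ∂ν) atTop
      (𝓝 (entropyNeg ν μ)) := by
    refine lintegral_tendsto_of_tendsto_of_monotone (fun k => ?_)
      (Eventually.of_forall fun x k l hkl => ?_) (Eventually.of_forall fun x => ?_)
    · exact (measurable_const.max (measurable_density.min
        measurable_const)).log.ennreal_ofReal.aemeasurable
    · have : (k : ℝ) ≤ l := by exact_mod_cast hkl
      exact ENNReal.ofReal_le_ofReal (Real.log_le_log (zero_lt_one.trans_le (le_max_left _ _))
        (max_le_max le_rfl (min_le_min le_rfl (by linarith))))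
    · obtain ⟨k₀, hk₀⟩ := exists_nat_ge (density ν μ x)
      refine tendsto_const_nhds.congr' ?_
      filter_upwards [eventually_ge_atTop k₀] with k hk
      have : (k₀ : ℝ) ≤ k := by exact_mod_cast hk
      rw [min_eq_left (by linarith)]
      change ENNReal.ofReal (Real.log (density ν μ x)) = _
      rcases le_total (density ν μ x) 1 with h | h
      · rw [max_eq_left h, Real.log_one,
          ENNReal.ofReal_of_nonpos (Real.log_nonpos (density_nonneg x) h), ENNReal.ofReal_zero]
      · rw [max_eq_right h]
  refine le_of_tendsto hlim (Eventually.of_forall fun k => ?_)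
  have h1 : (1 : ℝ) ≤ k + 1 := by have := k.cast_nonneg (α := ℝ); linarith
  rw [← ofReal_integral_eq_lintegral_ofReal (integrable_log_max _ h1)
    (Eventually.of_forall fun x => Real.log_nonneg (le_max_left _ _))]
  exact ENNReal.ofReal_le_ofReal (hK _ h1)

/-- As `N ≥ 1`, the truncation only lowers a nonnegative logarithm to another nonnegative value;
`|ln u|` thus dominates for all `N`. -/
theorem abs_log_min_le {u N : ℝ} (hN : 1 ≤ N) :
    |Real.log (min u N)| ≤ |Real.log u| := by
  rcases le_total u N with h | h
  · rw [min_eq_left h]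
  · rw [min_eq_right h, abs_of_nonneg (Real.log_nonneg hN),
      abs_of_nonneg (Real.log_nonneg (hN.trans h))]
    exact Real.log_le_log (by linarith) h

theorem integrable_log_min
    (hint : Integrable (fun x => Real.log (density ν μ x)) ν) {N : ℝ} (hN : 1 ≤ N) :
    Integrable (fun x => Real.log (min (density ν μ x) N)) ν := by
  refine hint.mono (measurable_density.min measurable_const).log.aestronglyMeasurable ?_
  exact Eventually.of_forall fun x => abs_log_min_le hN

theorem tendsto_integral_log_min
    (hint : Integrable (fun x => Real.log (density ν μ x)) ν) :
    Tendsto (fun N : ℝ => ∫ x, Real.log (min (density ν μ x) N) ∂ν) atTop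
      (𝓝 (∫ x, Real.log (density ν μ x) ∂ν)) := by
  refine tendsto_integral_filter_of_dominated_convergence
    (fun x => |Real.log (density ν μ x)|) ?_ ?_ hint.abs ?_
  · exact Eventually.of_forall fun N =>
      (measurable_density.min measurable_const).log.aestronglyMeasurable
  · filter_upwards [eventually_ge_atTop 1] with N hN
    exact Eventually.of_forall fun x => abs_log_min_le hN
  · refine Eventually.of_forall fun x => tendsto_const_nhds.congr' ?_
    filter_upwards [eventually_ge_atTop (density ν μ x)] with N hN
    rw [min_eq_left hN]

theorem integrable_log_density (hP : entropyPos ν μ ≠ ⊤) (hN : entropyNeg ν μ ≠ ⊤) :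
    Integrable (fun x => Real.log (density ν μ x)) ν := by
  refine ⟨measurable_density.log.aestronglyMeasurable, ?_⟩
  have h : ∀ t : ℝ, ‖t‖ₑ ≤ ENNReal.ofReal (-t) + ENNReal.ofReal t := fun t => by
    rw [← ofReal_norm, Real.norm_eq_abs]
    rcases abs_cases t with ⟨h, -⟩ | ⟨h, -⟩ <;> rw [h]
    · exact le_add_self
    · exact le_self_add
  calc ∫⁻ x, ‖Real.log (density ν μ x)‖ₑ ∂ν
      ≤ ∫⁻ x, (ENNReal.ofReal (-Real.log (density ν μ x)) +
          ENNReal.ofReal (Real.log (density ν μ x))) ∂ν := lintegral_mono fun x => h _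
    _ = entropyPos ν μ + entropyNeg ν μ :=
        lintegral_add_left measurable_density.log.neg.ennreal_ofReal _
    _ < ⊤ := ENNReal.add_lt_top.2 ⟨lt_top_iff_ne_top.2 hP, lt_top_iff_ne_top.2 hN⟩

theorem toReal_entropyPos_sub (hint : Integrable (fun x => Real.log (density ν μ x)) ν) :
    (entropyPos ν μ).toReal - (entropyNeg ν μ).toReal = -∫ x, Real.log (density ν μ x) ∂ν := by
  rw [integral_eq_lintegral_pos_part_sub_lintegral_neg_part hint, neg_sub]
  rfl

end Truncation

/-! ### The uncertainty relation -/

section Uncertainty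

variable {ι : Type*} {φ : ι → L2x n} {R τ : ℝ} {ν ν' : Measure (Rn n)}

theorem IsDensityFamily.isFiniteMeasure (hφ : IsDensityFamily φ R τ ν ν') :
    IsFiniteMeasure ν ∧ IsFiniteMeasure ν' :=
  ⟨⟨by rw [hφ.position_univ]; exact ENNReal.ofReal_lt_top⟩,
    ⟨by rw [hφ.momentum_univ]; exact ENNReal.ofReal_lt_top⟩⟩

theorem IsDensityFamily.position_ac (hφ : IsDensityFamily φ R τ ν ν') : ν ≪ volume := by
  rw [hφ.position]
  exact Measure.absolutelyContinuous_sum_left fun i => withDensity_absolutelyContinuous _ _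

theorem IsDensityFamily.momentum_ac (hφ : IsDensityFamily φ R τ ν ν') : ν' ≪ volStar n := by
  rw [hφ.momentum]
  exact Measure.absolutelyContinuous_sum_left fun i => withDensity_absolutelyContinuous _ _

theorem lt_min_of_pos {u N : ℝ} (hN : 1 ≤ N) (hu : 0 < u) : 0 < min u N :=
  lt_min hu (zero_lt_one.trans_le hN)

theorem IsDensityFamily.entropyNeg_position_ne_top (hφ : IsDensityFamily φ R τ ν ν')
    (h : entropyPos ν' (volStar n) ≠ ⊤) : entropyNeg ν volume ≠ ⊤ := by
  obtain ⟨_, _⟩ := hφ.isFiniteMeasure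
  have hτ := hφ.mass_pos
  -- Here `D = 1`, `M' = 1` and `D' = 0`, so the only term of `halfBound` containing `N` is
  -- multiplied by `√0`. The bound is uniform in `N`.
  set C : ℝ := √(R * τ) * (√τ * √τ) + τ
  have hK : ∀ N : ℝ, 1 ≤ N → ∫ x, Real.log (max 1 (min (density ν volume x) N)) ∂ν ≤
      τ * (2 * Real.log (C / τ)) - ∫ ξ, Real.log (min (density ν' (volStar n) ξ) 1) ∂ν' := by
    intro N hN
    have hC : halfBound R τ N 1 τ 1 0 τ = C := by simp [halfBound, C]
    have := integral_log_add_integral_log_le hφ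
      (isCutoff_max_density hφ.position_ac hτ.le hφ.position_univ hN)
      (isCutoff_min_density hφ.momentum_ac hτ.le hφ.momentum_univ zero_le_one)
      (measurable_const.max (measurable_density.min measurable_const))
      (measurable_density.min measurable_const)
      (Eventually.of_forall fun x => zero_lt_one.trans_le (le_max_left _ _))
      ((density_pos hφ.momentum_ac).mono fun x hx => lt_min_of_pos le_rfl hx)
      (integrable_log_max N hN) (integrable_log_min_one h) (by rw [hC]; positivity)
    rw [hC] at this
    linarith
  exact ne_top_of_le_ne_top ENNReal.ofReal_ne_top (entropyNeg_le_of_forall hK)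

theorem IsDensityFamily.entropyNeg_momentum_ne_top (hφ : IsDensityFamily φ R τ ν ν')
    (h : entropyPos ν volume ≠ ⊤) : entropyNeg ν' (volStar n) ≠ ⊤ := by
  obtain ⟨_, _⟩ := hφ.isFiniteMeasure
  have hτ := hφ.mass_pos
  set C : ℝ := √(R * τ) * (√τ * √τ) + τ
  have hK : ∀ N : ℝ, 1 ≤ N → ∫ x, Real.log (max 1 (min (density ν' (volStar n) x) N)) ∂ν' ≤
      τ * (2 * Real.log (C / τ)) - ∫ ξ, Real.log (min (density ν volume ξ) 1) ∂ν := by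
    intro N hN
    have hC : halfBound R τ 1 0 τ N 1 τ = C := by simp [halfBound, C]
    have := integral_log_add_integral_log_le hφ
      (isCutoff_min_density hφ.position_ac hτ.le hφ.position_univ zero_le_one)
      (isCutoff_max_density hφ.momentum_ac hτ.le hφ.momentum_univ hN)
      (measurable_density.min measurable_const)
      (measurable_const.max (measurable_density.min measurable_const))
      ((density_pos hφ.position_ac).mono fun x hx => lt_min_of_pos le_rfl hx)
      (Eventually.of_forall fun x => zero_lt_one.trans_le (le_max_left _ _))
      (integrable_log_min_one h) (integrable_log_max N hN) (by rw [hC]; positivity)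
    rw [hC] at this
    linarith
  exact ne_top_of_le_ne_top ENNReal.ofReal_ne_top (entropyNeg_le_of_forall hK)

theorem IsDensityFamily.entropy_sum_ge (hφ : IsDensityFamily φ R τ ν ν') (hR : 0 < R)
    (h : entropyPos ν volume ≠ ⊤) (h' : entropyPos ν' (volStar n) ≠ ⊤) :
    -τ * (Real.log τ + Real.log R) ≤
      ((entropyPos ν volume).toReal - (entropyNeg ν volume).toReal) +
        ((entropyPos ν' (volStar n)).toReal - (entropyNeg ν' (volStar n)).toReal) := by
  obtain ⟨_, _⟩ := hφ.isFiniteMeasure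
  have hτ := hφ.mass_pos
  have hi := integrable_log_density h (hφ.entropyNeg_position_ne_top h')
  have hi' := integrable_log_density h' (hφ.entropyNeg_momentum_ne_top h)
  have hpos := density_pos hφ.position_ac
  have hpos' := density_pos hφ.momentum_ac
  rw [toReal_entropyPos_sub hi, toReal_entropyPos_sub hi']
  have hlim := (tendsto_integral_log_min hi).add (tendsto_integral_log_min hi')
  have hb : ∫ x, Real.log (density ν volume x) ∂ν + ∫ x, Real.log (density ν' (volStar n) x) ∂ν' ≤
      τ * (Real.log τ + Real.log R) := by
    refine le_of_tendsto hlim ?_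
    filter_upwards [eventually_ge_atTop 1] with N hN
    have hN0 : 0 ≤ N := zero_le_one.trans hN
    -- With `D = D' = 0` only the Hilbert-Schmidt term remains, and `2 ln √(Rτ) = ln R + ln τ` is
    -- the sharp constant of the statement.
    have hC : halfBound R τ N 0 τ N 0 τ = √(R * τ) * τ := by
      simp [halfBound, Real.mul_self_sqrt hτ.le]
    have := integral_log_add_integral_log_le hφ
      (isCutoff_min_density hφ.position_ac hτ.le hφ.position_univ hN0)
      (isCutoff_min_density hφ.momentum_ac hτ.le hφ.momentum_univ hN0)
      (measurable_density.min measurable_const) (measurable_density.min measurable_const)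
      (hpos.mono fun x hx => lt_min_of_pos hN hx) (hpos'.mono fun x hx => lt_min_of_pos hN hx)
      (integrable_log_min hi hN) (integrable_log_min hi' hN) (by rw [hC]; positivity)
    rw [hC, mul_div_assoc, div_self hτ.ne', mul_one, Real.log_sqrt (by positivity),
      Real.log_mul hR.ne' hτ.ne'] at this
    linarith
  linarith

/-- The bound for the sum of two differences `P - N` in `[-∞, ∞]`, in the form with a sum and in
the rearranged form, follows from the bound for finite values. -/
theorem ereal_sum_bound {P N P' N' : ℝ≥0∞} {c : ℝ} (h : P ≠ ⊤ ∨ P' ≠ ⊤) (h1 : P' ≠ ⊤ → N ≠ ⊤)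
    (h2 : P ≠ ⊤ → N' ≠ ⊤)
    (h3 : P ≠ ⊤ → P' ≠ ⊤ → c ≤ (P.toReal - N.toReal) + (P'.toReal - N'.toReal)) :
    (¬ ((P : EReal) - N = ⊤ ∧ (P' : EReal) - N' = ⊥) →
      ¬ ((P : EReal) - N = ⊥ ∧ (P' : EReal) - N' = ⊤) →
      (c : EReal) ≤ ((P : EReal) - N) + ((P' : EReal) - N')) ∧
    (c : EReal) - ((P' : EReal) - N') ≤ (P : EReal) - N := by
  have htop : ∀ a : ℝ≥0∞, a ≠ ⊤ → ((⊤ : ℝ≥0∞) : EReal) - (a : EReal) = ⊤ := fun a ha => by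
    lift a to NNReal using ha
    exact EReal.top_sub_coe a
  -- If one positive part is infinite, the other is finite by `h`, which makes the negative part
  -- paired with the infinite one finite: that difference is `⊤`. Otherwise all four quantities are
  -- finite.
  by_cases hP : P = ⊤
  · have hP' : P' ≠ ⊤ := h.resolve_left (not_not.2 hP)
    subst hP
    rw [htop N (h1 hP')]
    refine ⟨fun ha _ => ?_, le_top⟩
    rw [EReal.top_add_of_ne_bot fun hb => ha ⟨rfl, hb⟩]
    exact le_top
  by_cases hP' : P' = ⊤
  · subst hP'
    rw [htop N' (h2 hP)]
    refine ⟨fun _ ha => ?_, ?_⟩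
    · rw [EReal.add_top_of_ne_bot fun hb => ha ⟨hb, rfl⟩]
      exact le_top
    · simp
  · have h4 := h3 hP hP'
    have hN := h1 hP'
    have hN' := h2 hP
    rw [← EReal.coe_ennreal_toReal hP, ← EReal.coe_ennreal_toReal hP',
      ← EReal.coe_ennreal_toReal hN, ← EReal.coe_ennreal_toReal hN', ← EReal.coe_sub,
      ← EReal.coe_sub, ← EReal.coe_add, ← EReal.coe_sub, EReal.coe_le_coe_iff, EReal.coe_le_coe_iff]
    exact ⟨fun _ _ => h4, by linarith⟩

end Uncertainty

end FourierEntropy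

end

theorem mainTheorem5 (n : ℕ) (ρ : L2x n →L[ℂ] L2x n) (hρ : IsState ρ)
    (hpos : entropyPos (nu ρ) volume ≠ ⊤ ∨ entropyPos (nu (hatOp ρ)) (volStar n) ≠ ⊤) :
    -- if the positive part of one entropy is finite, then so is the negative part of the other
    (entropyPos (nu (hatOp ρ)) (volStar n) ≠ ⊤ → entropyNeg (nu ρ) volume ≠ ⊤) ∧
    (entropyPos (nu ρ) volume ≠ ⊤ → entropyNeg (nu (hatOp ρ)) (volStar n) ≠ ⊤) ∧
    -- the bound for the sum, unless the sum has the undefined form `∞ - ∞`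
    (¬ (entropy (nu ρ) volume = ⊤ ∧ entropy (nu (hatOp ρ)) (volStar n) = ⊥) →
      ¬ (entropy (nu ρ) volume = ⊥ ∧ entropy (nu (hatOp ρ)) (volStar n) = ⊤) →
      ((-(trace ρ).toReal * (Real.log (trace ρ).toReal + Real.log ‖ρ‖) : ℝ) : EReal) ≤
        entropy (nu ρ) volume + entropy (nu (hatOp ρ)) (volStar n)) ∧
    -- the same bound rearranged, which is meaningful in all cases: if one of the entropies is `-∞`,
    -- then the other one is `+∞`
    ((-(trace ρ).toReal * (Real.log (trace ρ).toReal + Real.log ‖ρ‖) : ℝ) : EReal) -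
        entropy (nu (hatOp ρ)) (volStar n) ≤ entropy (nu ρ) volume := by
  by_cases h0 : trace ρ = 0
  · have hν : nu ρ = 0 := Measure.measure_univ_eq_zero.1 ((nu_univ hρ.isPositive).trans h0)
    have hν' : nu (hatOp ρ) = 0 :=
      Measure.measure_univ_eq_zero.1 ((nu_hatOp_univ hρ.isPositive).trans h0)
    -- Both measures vanish, so both entropies are `0`; the right side is `0` because of its factor
    -- `τ`, whatever the logarithms are.
    simp [hν, hν', h0, entropy, entropyPos, entropyNeg]
  · have hφ := hρ.isDensityFamily h0
    have hR : 0 < ‖ρ‖ := norm_pos_iff.2 fun h => h0 (by simp [h, trace])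
    exact ⟨hφ.entropyNeg_position_ne_top, hφ.entropyNeg_momentum_ne_top,
      ereal_sum_bound hpos hφ.entropyNeg_position_ne_top hφ.entropyNeg_momentum_ne_top
        (hφ.entropy_sum_ge hR)⟩
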